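/- Let $k$ be a field, let $A=\bigoplus_{i\ge 0}A_i$ and $B=\bigoplus_{i\ge 0}B_i$ be $\mathbb N$-graded associative unital $k$-algebras, and write $\otimes=\otimes_k$, $A_+=\bigoplus_{i>0}A_i$, $B_+=\bigoplus_{i>0}B_i$. Let $\mu_A,\mu_B$ be the multiplication maps, and grade $A\otimes B$ by $(A\otimes B)_n=\bigoplus_{p+q=n}A_p\otimes B_q$, and $B\otimes A$ likewise. A *graded twisting map* is a $k$-linear map $\tau:B\otimes A\to A\otimes B$ such that $\tau((B\otimes A)_n)\subseteq (A\otimes B)_n$ for all $n$, $\tau(1\otimes a)=a\otimes 1$ and $\tau(b\otimes 1)=1\otimes b$ for all $a\in A$, $b\in B$, and $$\tau(\mu_B\otimes\mu_A)=(\mu_A\otimes\mu_B)(1_A\otimes\tau\otimes 1_B)(\tau\otimes\tau)(1_B\otimes\tau\otimes 1_A)$$ on $B\otimes B\otimes A\otimes A$. The *twisted tensor product* $A\otimes_\tau B$ is the graded algebra with underlying graded space $A\otimes B$, multiplication $(\mu_A\otimes\mu_B)(1_A\otimes\tau\otimes 1_B)$ and unit $1\otimes 1$. The map $\tau$ is *one-sided*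 if $$\tau(B_+\otimes A_+)\subseteq (A_+\otimes B_0)\oplus(A_+\otimes B_+)\quad\text{or}\quad \tau(B_+\otimes A_+)\subseteq (A_+\otimes B_+)\oplus(A_0\otimes B_+).$$ Let $R=\bigoplus_{i\ge0} R_i$ be an $\mathbb N$-graded $k$-algebra that is connected ($\dim_k R_0=1$) and locally finite dimensional ($\dim_k R_i<\infty$ for all $i$). Let $\pi:T(R_1)\to R$ be the canonical algebra map from the tensor algebra. Then $R$ is *quadratic* if $\pi$ is surjective and $\ker\pi$ is the two-sided ideal generated by $\ker\pi\cap(R_1\otimes R_1)$. And $R$ is *Koszul* if the trivial left module $R/R_+$ has a resolution $\cdots\to P_2\to P_1\to P_0\to R/R_+\to 0$ by graded free left $R$-modules and graded (degree-preserving) maps such that each $P_i$ is generated in degree $i$. Being quadratic or Koszul includes being connected and locally finite dimensional. **Theorem.** Let $\tau:B\otimes A\to A\otimes B$ be a one-sided graded twisting map. 1. If $A$ and $B$ are quadratic, then $A\otimes_\tau B$ is quadratic. 2. If $A$ and $B$ are Koszul, then $A\otimes_\tau B$ is Koszul. -/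

import Mathlib

open scoped TensorProduct DirectSum

noncomputable section

namespace TwistedKoszul

/-! ### Graded tensor products of vector spaces -/

section Tensor

variable {k : Type*} [Field k]

/-- The subspace `S ⊗ T` of `V ⊗ W`, for subspaces `S ⊆ V` and `T ⊆ W`. -/
def tensorSub {V W : Type*} [AddCommGroup V] [Module k V] [AddCommGroup W] [Module k W]
    (S : Submodule k V) (T : Submodule k W) : Submodule k (V ⊗[k] W) :=
  LinearMap.range (TensorProduct.mapIncl S T)

/-- The Künneth grading: `(V ⊗ W)_n` is the sum of the subspaces `V_p ⊗ W_q` with `p + q = n`. -/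
def kunneth {V W : Type*} [AddCommGroup V] [Module k V] [AddCommGroup W] [Module k W]
    (𝒱 : ℕ → Submodule k V) (𝒲 : ℕ → Submodule k W) (n : ℕ) : Submodule k (V ⊗[k] W) :=
  ⨆ p : ℕ, ⨆ q : ℕ, ⨆ _ : p + q = n, tensorSub (𝒱 p) (𝒲 q)

/-- The positive part `V_+ = ⨁_{i > 0} V_i` of a graded vector space. -/
def positivePart {V : Type*} [AddCommGroup V] [Module k V] (𝒱 : ℕ → Submodule k V) :
    Submodule k V :=
  ⨆ i : ℕ, ⨆ _ : 0 < i, 𝒱 i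

/-- For `f : V ⊗ W → X ⊗ Y`, the map
`1_U ⊗ f ⊗ 1_Z : U ⊗ V ⊗ W ⊗ Z → U ⊗ X ⊗ Y ⊗ Z`, with source and target bracketed in pairs. -/
def middleMap {U V W X Y Z : Type*}
    [AddCommGroup U] [Module k U] [AddCommGroup V] [Module k V] [AddCommGroup W] [Module k W]
    [AddCommGroup X] [Module k X] [AddCommGroup Y] [Module k Y] [AddCommGroup Z] [Module k Z]
    (f : V ⊗[k] W →ₗ[k] X ⊗[k] Y) :
    (U ⊗[k] V) ⊗[k] (W ⊗[k] Z) →ₗ[k] (U ⊗[k] X) ⊗[k] (Y ⊗[k] Z) :=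
  (TensorProduct.assoc k U X (Y ⊗[k] Z)).symm.toLinearMap ∘ₗ
    LinearMap.lTensor U
      ((TensorProduct.assoc k X Y Z).toLinearMap ∘ₗ LinearMap.rTensor Z f ∘ₗ
        (TensorProduct.assoc k V W Z).symm.toLinearMap) ∘ₗ
    (TensorProduct.assoc k U V (W ⊗[k] Z)).toLinearMap

theorem tmul_mem_kunneth {V W : Type*} [AddCommGroup V] [Module k V] [AddCommGroup W]
    [Module k W] {𝒱 : ℕ → Submodule k V} {𝒲 : ℕ → Submodule k W} {p q : ℕ} {v : V} {w : W}
    (hv : v ∈ 𝒱 p) (hw : w ∈ 𝒲 q) : v ⊗ₜ[k] w ∈ kunneth 𝒱 𝒲 (p + q) :=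
  (le_iSup_of_le p (le_iSup_of_le q (le_iSup_of_le rfl le_rfl)) :
    tensorSub (𝒱 p) (𝒲 q) ≤ kunneth 𝒱 𝒲 (p + q)) ⟨⟨v, hv⟩ ⊗ₜ ⟨w, hw⟩, rfl⟩

theorem kunneth_le {V W : Type*} [AddCommGroup V] [Module k V] [AddCommGroup W]
    [Module k W] {𝒱 : ℕ → Submodule k V} {𝒲 : ℕ → Submodule k W} {n : ℕ}
    {P : Submodule k (V ⊗[k] W)}
    (h : ∀ p q, p + q = n → ∀ v ∈ 𝒱 p, ∀ w ∈ 𝒲 q, v ⊗ₜ[k] w ∈ P) : kunneth 𝒱 𝒲 n ≤ P := by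
  refine iSup_le fun p => iSup_le fun q => iSup_le fun hpq => ?_
  rintro _ ⟨t, rfl⟩
  induction t with
  | zero => simp
  | tmul v w => exact h p q hpq v v.2 w w.2
  | add s t hs ht => rw [map_add]; exact P.add_mem hs ht

/-- The subspaces `(V ⊗ W)_n` are the homogeneous components of a grading of `V ⊗ W`. -/
@[reducible] def kunnethDecomposition {V W : Type*} [AddCommGroup V] [Module k V] [AddCommGroup W]
    [Module k W] (𝒱 : ℕ → Submodule k V) (𝒲 : ℕ → Submodule k W)
    [DirectSum.Decomposition 𝒱] [DirectSum.Decomposition 𝒲] :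
    DirectSum.Decomposition (kunneth 𝒱 𝒲) := by
  have hmem : ∀ (i : ℕ × ℕ) (t : 𝒱 i.1 ⊗[k] 𝒲 i.2),
      TensorProduct.mapIncl (𝒱 i.1) (𝒲 i.2) t ∈ kunneth 𝒱 𝒲 (i.1 + i.2) := fun i t =>
    (le_iSup_of_le i.1 (le_iSup_of_le i.2 (le_iSup_of_le rfl le_rfl)) :
      tensorSub (𝒱 i.1) (𝒲 i.2) ≤ kunneth 𝒱 𝒲 (i.1 + i.2)) ⟨t, rfl⟩
  let D : V ⊗[k] W →ₗ[k] ⨁ n, kunneth 𝒱 𝒲 n :=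
    DirectSum.toModule k (ℕ × ℕ) _ (fun i =>
      DirectSum.lof k ℕ (fun n => kunneth 𝒱 𝒲 n) (i.1 + i.2) ∘ₗ
        LinearMap.codRestrict _ (TensorProduct.mapIncl (𝒱 i.1) (𝒲 i.2)) (hmem i)) ∘ₗ
    (TensorProduct.directSum k k (fun i => 𝒱 i) (fun i => 𝒲 i)).toLinearMap ∘ₗ
    TensorProduct.map (DirectSum.decomposeLinearEquiv 𝒱).toLinearMap
      (DirectSum.decomposeLinearEquiv 𝒲).toLinearMap
  have hD : ∀ (p q : ℕ) (v : V) (hv : v ∈ 𝒱 p) (w : W) (hw : w ∈ 𝒲 q),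
      D (v ⊗ₜ w) = DirectSum.lof k ℕ (fun n => kunneth 𝒱 𝒲 n) (p + q)
        ⟨v ⊗ₜ w, tmul_mem_kunneth hv hw⟩ := by
    intro p q v hv w hw
    simp only [D, LinearMap.comp_apply, TensorProduct.map_tmul, LinearEquiv.coe_coe,
      DirectSum.decomposeLinearEquiv_apply, DirectSum.decompose_of_mem 𝒱 hv,
      DirectSum.decompose_of_mem 𝒲 hw]
    erw [TensorProduct.directSum_lof_tmul_lof, DirectSum.toModule_lof]
    rfl
  have hleft : DirectSum.coeLinearMap (kunneth 𝒱 𝒲) ∘ₗ D = LinearMap.id := by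
    refine TensorProduct.ext' fun v w => ?_
    refine DirectSum.Decomposition.inductionOn 𝒱 (by simp) (fun {p} v => ?_)
      (fun v v' h h' => by rw [TensorProduct.add_tmul, map_add, map_add, h, h']) v
    refine DirectSum.Decomposition.inductionOn 𝒲 (by simp) (fun {q} w => ?_)
      (fun w w' h h' => by rw [TensorProduct.tmul_add, map_add, map_add, h, h']) w
    rw [LinearMap.comp_apply, hD p q v v.2 w w.2]
    exact DirectSum.coeLinearMap_lof _ _ _
  have hright : D ∘ₗ DirectSum.coeLinearMap (kunneth 𝒱 𝒲) = LinearMap.id := by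
    refine DirectSum.linearMap_ext k fun n => ?_
    refine LinearMap.ext fun x => ?_
    have key : kunneth 𝒱 𝒲 n ≤
        (LinearMap.range (DirectSum.lof k ℕ (fun n => kunneth 𝒱 𝒲 n) n)).comap D := by
      refine kunneth_le fun p q hpq v hv w hw => ?_
      subst hpq
      exact ⟨_, (hD p q v hv w hw).symm⟩
    obtain ⟨y, hy⟩ := key x.2
    have hxy : y = x := by
      have h := congrArg (DirectSum.coeLinearMap (kunneth 𝒱 𝒲)) hy
      rw [← LinearMap.comp_apply _ D, hleft] at h
      exact Subtype.ext ((DirectSum.coeLinearMap_lof _ _ _).symm.trans h)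
    subst hxy
    simp only [LinearMap.comp_apply, LinearMap.id_apply]
    rw [DirectSum.coeLinearMap_lof]
    exact hy.symm
  exact DirectSum.Decomposition.ofLinearMap _ D hleft hright

end Tensor

/-! ### Twisting maps and twisted tensor products -/

section Twisting

variable {k A B : Type*} [Field k] [Ring A] [Algebra k A] [Ring B] [Algebra k B]

/-- The multiplication `μ_τ = (μ_A ⊗ μ_B)(1_A ⊗ τ ⊗ 1_B)` on `A ⊗ B`. -/
def twistedMul (τ : B ⊗[k] A →ₗ[k] A ⊗[k] B) :
    (A ⊗[k] B) ⊗[k] (A ⊗[k] B) →ₗ[k] A ⊗[k] B :=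
  TensorProduct.map (LinearMap.mul' k A) (LinearMap.mul' k B) ∘ₗ middleMap τ

variable (k A B) in
/-- An algebra twisting map `τ : B ⊗ A → A ⊗ B`: a `k`-linear map with `τ(1 ⊗ a) = a ⊗ 1`,
`τ(b ⊗ 1) = 1 ⊗ b` and
`τ(μ_B ⊗ μ_A) = (μ_A ⊗ μ_B)(1_A ⊗ τ ⊗ 1_B)(τ ⊗ τ)(1_B ⊗ τ ⊗ 1_A)` on `B ⊗ B ⊗ A ⊗ A`. -/
structure TwistingMap where
  /-- The underlying linear map. -/
  toMap : B ⊗[k] A →ₗ[k] A ⊗[k] B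
  map_one_tmul : ∀ a : A, toMap (1 ⊗ₜ a) = a ⊗ₜ 1
  map_tmul_one : ∀ b : B, toMap (b ⊗ₜ 1) = 1 ⊗ₜ b
  map_mul_mul : toMap ∘ₗ TensorProduct.map (LinearMap.mul' k B) (LinearMap.mul' k A) =
    TensorProduct.map (LinearMap.mul' k A) (LinearMap.mul' k B) ∘ₗ middleMap toMap ∘ₗ
      TensorProduct.map toMap toMap ∘ₗ middleMap toMap

/-- A graded twisting map: a twisting map that preserves the Künneth gradings. -/
structure GradedTwistingMap (𝒜 : ℕ → Submodule k A) (ℬ : ℕ → Submodule k B) extends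
    TwistingMap k A B where
  map_mem : ∀ n : ℕ, ∀ x ∈ kunneth ℬ 𝒜 n, toMap x ∈ kunneth 𝒜 ℬ n

/-- A graded twisting map is one-sided if
`τ(B_+ ⊗ A_+) ⊆ (A_+ ⊗ B_0) ⊕ (A_+ ⊗ B_+)` or `τ(B_+ ⊗ A_+) ⊆ (A_+ ⊗ B_+) ⊕ (A_0 ⊗ B_+)`. -/
def GradedTwistingMap.IsOneSided {𝒜 : ℕ → Submodule k A} {ℬ : ℕ → Submodule k B}
    (τ : GradedTwistingMap 𝒜 ℬ) : Prop :=
  (∀ x ∈ tensorSub (positivePart ℬ) (positivePart 𝒜), τ.toMap x ∈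
    tensorSub (positivePart 𝒜) (ℬ 0) ⊔ tensorSub (positivePart 𝒜) (positivePart ℬ)) ∨
  (∀ x ∈ tensorSub (positivePart ℬ) (positivePart 𝒜), τ.toMap x ∈
    tensorSub (positivePart 𝒜) (positivePart ℬ) ⊔ tensorSub (𝒜 0) (positivePart ℬ))

theorem twistedMul_tmul_tmul (τ : B ⊗[k] A →ₗ[k] A ⊗[k] B) (a a' : A) (b b' : B) :
    twistedMul τ ((a ⊗ₜ b) ⊗ₜ (a' ⊗ₜ b')) =
      TensorProduct.map (LinearMap.mulLeft k a) (LinearMap.mulRight k b') (τ (b ⊗ₜ a')) := by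
  simp only [twistedMul, middleMap, LinearMap.comp_apply, LinearEquiv.coe_coe,
    TensorProduct.assoc_tmul, LinearMap.lTensor_tmul, TensorProduct.assoc_symm_tmul,
    LinearMap.rTensor_tmul]
  induction τ (b ⊗ₜ a') with
  | zero => simp
  | tmul x y => simp
  | add x y hx hy =>
    simp only [TensorProduct.add_tmul, TensorProduct.tmul_add, map_add, hx, hy]

namespace TwistingMap

theorem map_tmul_mul (τ : TwistingMap k A B) (b : B) (a a' : A) :
    τ.toMap (b ⊗ₜ (a * a')) = twistedMul τ.toMap (τ.toMap (b ⊗ₜ a) ⊗ₜ (a' ⊗ₜ 1)) := by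
  have h := LinearMap.congr_fun τ.map_mul_mul ((b ⊗ₜ 1) ⊗ₜ (a ⊗ₜ a'))
  simpa [middleMap, twistedMul, τ.map_one_tmul] using h

theorem map_mul_tmul (τ : TwistingMap k A B) (b b' : B) (a : A) :
    τ.toMap ((b * b') ⊗ₜ a) = twistedMul τ.toMap ((1 ⊗ₜ b) ⊗ₜ τ.toMap (b' ⊗ₜ a)) := by
  have h := LinearMap.congr_fun τ.map_mul_mul ((b ⊗ₜ b') ⊗ₜ (1 ⊗ₜ a))
  simp only [LinearMap.comp_apply, TensorProduct.map_tmul, LinearMap.mul'_apply, one_mul] at h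
  rw [h, twistedMul, LinearMap.comp_apply]
  congr 2
  simp [middleMap, τ.map_tmul_one]

theorem twistedMul_assoc (τ : TwistingMap k A B) (x y z : A ⊗[k] B) :
    twistedMul τ.toMap (twistedMul τ.toMap (x ⊗ₜ y) ⊗ₜ z) =
      twistedMul τ.toMap (x ⊗ₜ twistedMul τ.toMap (y ⊗ₜ z)) := by
  have left : ∀ (u : A ⊗[k] B) (a₁ a₃ : A) (b₂ b₃ : B),
      twistedMul τ.toMap
        (TensorProduct.map (LinearMap.mulLeft k a₁) (LinearMap.mulRight k b₂) u ⊗ₜ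
          (a₃ ⊗ₜ b₃)) =
      TensorProduct.map (LinearMap.mulLeft k a₁) (LinearMap.mulRight k b₃)
        (twistedMul τ.toMap (u ⊗ₜ τ.toMap (b₂ ⊗ₜ a₃))) := by
    intro u a₁ a₃ b₂ b₃
    induction u with
    | zero => simp
    | add u v hu hv => simp only [map_add, TensorProduct.add_tmul, hu, hv]
    | tmul a b =>
      rw [TensorProduct.map_tmul, twistedMul_tmul_tmul, LinearMap.mulRight_apply,
        map_mul_tmul]
      induction τ.toMap (b₂ ⊗ₜ a₃) with
      | zero => simp
      | add u v hu hv => simp only [map_add, TensorProduct.tmul_add, hu, hv]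
      | tmul a' b' =>
        rw [twistedMul_tmul_tmul, twistedMul_tmul_tmul]
        induction τ.toMap (b ⊗ₜ a') with
        | zero => simp
        | add u v hu hv => simp only [map_add, hu, hv]
        | tmul a'' b'' => simp [mul_assoc]
  have right : ∀ (u : A ⊗[k] B) (a₁ a₂ : A) (b₁ b₃ : B),
      twistedMul τ.toMap ((a₁ ⊗ₜ b₁) ⊗ₜ
        TensorProduct.map (LinearMap.mulLeft k a₂) (LinearMap.mulRight k b₃) u) =
      TensorProduct.map (LinearMap.mulLeft k a₁) (LinearMap.mulRight k b₃)
        (twistedMul τ.toMap (τ.toMap (b₁ ⊗ₜ a₂) ⊗ₜ u)) := by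
    intro u a₁ a₂ b₁ b₃
    induction u with
    | zero => simp
    | add u v hu hv => simp only [map_add, TensorProduct.tmul_add, hu, hv]
    | tmul a b =>
      rw [TensorProduct.map_tmul, twistedMul_tmul_tmul, LinearMap.mulLeft_apply,
        map_tmul_mul]
      induction τ.toMap (b₁ ⊗ₜ a₂) with
      | zero => simp
      | add u v hu hv => simp only [map_add, TensorProduct.add_tmul, hu, hv]
      | tmul a' b' =>
        rw [twistedMul_tmul_tmul, twistedMul_tmul_tmul]
        induction τ.toMap (b' ⊗ₜ a) with
        | zero => simp
        | add u v hu hv => simp only [map_add, hu, hv]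
        | tmul a'' b'' => simp [mul_assoc]
  induction x with
  | zero => simp
  | add x x' hx hx' => simp only [TensorProduct.add_tmul, map_add, hx, hx']
  | tmul a₁ b₁ =>
    induction y with
    | zero => simp
    | add y y' hy hy' =>
      simp only [TensorProduct.add_tmul, TensorProduct.tmul_add, map_add, hy, hy']
    | tmul a₂ b₂ =>
      induction z with
      | zero => simp
      | add z z' hz hz' => simp only [TensorProduct.tmul_add, map_add, hz, hz']
      | tmul a₃ b₃ =>
        rw [twistedMul_tmul_tmul, left, twistedMul_tmul_tmul _ a₂, right]

theorem one_twistedMul (τ : TwistingMap k A B) (x : A ⊗[k] B) :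
    twistedMul τ.toMap ((1 ⊗ₜ 1) ⊗ₜ x) = x := by
  induction x with
  | zero => simp
  | add x y hx hy => simp only [TensorProduct.tmul_add, map_add, hx, hy]
  | tmul a b => simp [twistedMul_tmul_tmul, τ.map_one_tmul]

theorem twistedMul_one (τ : TwistingMap k A B) (x : A ⊗[k] B) :
    twistedMul τ.toMap (x ⊗ₜ (1 ⊗ₜ 1)) = x := by
  induction x with
  | zero => simp
  | add x y hx hy => simp only [TensorProduct.add_tmul, map_add, hx, hy]
  | tmul a b => simp [twistedMul_tmul_tmul, τ.map_tmul_one]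

end TwistingMap

/-- The twisted tensor product `A ⊗_τ B`: the vector space `A ⊗ B`, with the multiplication `μ_τ`
and the unit `1 ⊗ 1`. -/
def TwistedTensorProduct (_τ : TwistingMap k A B) : Type _ := A ⊗[k] B

namespace TwistedTensorProduct

variable (τ : TwistingMap k A B)

instance instAddCommGroup : AddCommGroup (TwistedTensorProduct τ) :=
  inferInstanceAs (AddCommGroup (A ⊗[k] B))

instance instModule : Module k (TwistedTensorProduct τ) := inferInstanceAs (Module k (A ⊗[k] B))

/-- The identification of `A ⊗_τ B` with `A ⊗ B` as vector spaces. -/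
def toTensor : TwistedTensorProduct τ ≃ₗ[k] A ⊗[k] B := LinearEquiv.refl k (A ⊗[k] B)

instance : Mul (TwistedTensorProduct τ) :=
  ⟨fun x y => (toTensor τ).symm (twistedMul τ.toMap (toTensor τ x ⊗ₜ toTensor τ y))⟩

instance : One (TwistedTensorProduct τ) := ⟨(toTensor τ).symm (1 ⊗ₜ 1)⟩

theorem toTensor_mul (x y : TwistedTensorProduct τ) :
    toTensor τ (x * y) = twistedMul τ.toMap (toTensor τ x ⊗ₜ toTensor τ y) :=
  (toTensor τ).apply_symm_apply _

theorem toTensor_one : toTensor τ 1 = 1 ⊗ₜ 1 := (toTensor τ).apply_symm_apply _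

instance : Ring (TwistedTensorProduct τ) where
  __ := instAddCommGroup τ
  mul := (· * ·)
  one := 1
  left_distrib x y z := (toTensor τ).injective <| by
    simp only [toTensor_mul, map_add, TensorProduct.tmul_add]
  right_distrib x y z := (toTensor τ).injective <| by
    simp only [toTensor_mul, map_add, TensorProduct.add_tmul]
  zero_mul x := (toTensor τ).injective <| by
    simp only [toTensor_mul, map_zero, TensorProduct.zero_tmul]
  mul_zero x := (toTensor τ).injective <| by
    simp only [toTensor_mul, map_zero, TensorProduct.tmul_zero]
  mul_assoc x y z := (toTensor τ).injective <| by
    simp only [toTensor_mul, τ.twistedMul_assoc]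
  one_mul x := (toTensor τ).injective <| by
    simp only [toTensor_mul, toTensor_one, τ.one_twistedMul]
  mul_one x := (toTensor τ).injective <| by
    simp only [toTensor_mul, toTensor_one, τ.twistedMul_one]

instance : Algebra k (TwistedTensorProduct τ) :=
  Algebra.ofModule
    (fun c x y => (toTensor τ).injective <| by
      simp only [toTensor_mul, map_smul, ← TensorProduct.smul_tmul'])
    (fun c x y => (toTensor τ).injective <| by
      simp only [toTensor_mul, map_smul, TensorProduct.tmul_smul])

end TwistedTensorProduct

theorem GradedTwistingMap.twistedMul_mem {𝒜 : ℕ → Submodule k A} {ℬ : ℕ → Submodule k B}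
    [GradedAlgebra 𝒜] [GradedAlgebra ℬ] (τ : GradedTwistingMap 𝒜 ℬ) {m n : ℕ}
    {x y : A ⊗[k] B} (hx : x ∈ kunneth 𝒜 ℬ m) (hy : y ∈ kunneth 𝒜 ℬ n) :
    twistedMul τ.toMap (x ⊗ₜ y) ∈ kunneth 𝒜 ℬ (m + n) := by
  have h₁ : ∀ {i j p q : ℕ} (a : A) (b : B), a ∈ 𝒜 i → b ∈ ℬ j →
      ∀ u ∈ kunneth 𝒜 ℬ p, q = i + p + j →
      TensorProduct.map (LinearMap.mulLeft k a) (LinearMap.mulRight k b) u ∈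
        kunneth 𝒜 ℬ q := by
    intro i j p q a b ha hb u hu hq
    refine (kunneth_le (P := (kunneth 𝒜 ℬ q).comap
      (TensorProduct.map (LinearMap.mulLeft k a) (LinearMap.mulRight k b))) ?_) hu
    intro r s hrs v hv w hw
    have h := tmul_mem_kunneth (k := k) (SetLike.mul_mem_graded ha hv)
      (SetLike.mul_mem_graded hw hb)
    have e : i + r + (s + j) = q := by omega
    rw [e] at h
    simpa using h
  let M := TensorProduct.mk k (A ⊗[k] B) (A ⊗[k] B)
  refine (kunneth_le (P := (kunneth 𝒜 ℬ (m + n)).comap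
    (twistedMul τ.toMap ∘ₗ M.flip y)) ?_) hx
  intro p q hpq a ha b hb
  change twistedMul τ.toMap ((a ⊗ₜ b) ⊗ₜ y) ∈ kunneth 𝒜 ℬ (m + n)
  refine (kunneth_le (P := (kunneth 𝒜 ℬ (m + n)).comap
    (twistedMul τ.toMap ∘ₗ M (a ⊗ₜ b))) ?_) hy
  intro p' q' hpq' a' ha' b' hb'
  change twistedMul τ.toMap ((a ⊗ₜ b) ⊗ₜ (a' ⊗ₜ b')) ∈ kunneth 𝒜 ℬ (m + n)
  rw [twistedMul_tmul_tmul]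
  exact h₁ a b' ha hb' _ (τ.map_mem _ _ (tmul_mem_kunneth hb ha')) (by omega)

/-- The grading of `A ⊗_τ B`, which is the Künneth grading of `A ⊗ B`. -/
def GradedTwistingMap.grading {𝒜 : ℕ → Submodule k A} {ℬ : ℕ → Submodule k B}
    (τ : GradedTwistingMap 𝒜 ℬ) (n : ℕ) :
    Submodule k (TwistedTensorProduct τ.toTwistingMap) :=
  (kunneth 𝒜 ℬ n).comap (TwistedTensorProduct.toTensor τ.toTwistingMap).toLinearMap

theorem GradedTwistingMap.mem_grading {𝒜 : ℕ → Submodule k A} {ℬ : ℕ → Submodule k B}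
    (τ : GradedTwistingMap 𝒜 ℬ) {n : ℕ} {x : TwistedTensorProduct τ.toTwistingMap} :
    x ∈ τ.grading n ↔ TwistedTensorProduct.toTensor τ.toTwistingMap x ∈ kunneth 𝒜 ℬ n :=
  Iff.rfl

/-- `A ⊗_τ B` is the direct sum of the components of its grading. -/
@[reducible] def GradedTwistingMap.decomposition {𝒜 : ℕ → Submodule k A}
    {ℬ : ℕ → Submodule k B} [GradedAlgebra 𝒜] [GradedAlgebra ℬ] (τ : GradedTwistingMap 𝒜 ℬ) :
    DirectSum.Decomposition τ.grading := by
  let e := TwistedTensorProduct.toTensor τ.toTwistingMap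
  letI := kunnethDecomposition 𝒜 ℬ
  let f : ∀ n, kunneth 𝒜 ℬ n →ₗ[k] τ.grading n := fun n =>
    LinearMap.codRestrict _ (e.symm.toLinearMap ∘ₗ (kunneth 𝒜 ℬ n).subtype) fun x => by
      rw [τ.mem_grading]
      exact (e.apply_symm_apply x.1).symm ▸ x.2
  let F : (⨁ n, kunneth 𝒜 ℬ n) →ₗ[k] ⨁ n, τ.grading n := DirectSum.lmap f
  refine DirectSum.Decomposition.ofLinearMap _
    (F ∘ₗ (DirectSum.decomposeLinearEquiv (kunneth 𝒜 ℬ)).toLinearMap ∘ₗ e.toLinearMap) ?_ ?_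
  · have h : DirectSum.coeLinearMap τ.grading ∘ₗ F =
        e.symm.toLinearMap ∘ₗ DirectSum.coeLinearMap (kunneth 𝒜 ℬ) := by
      refine DirectSum.linearMap_ext k fun n => LinearMap.ext fun x => ?_
      simp only [LinearMap.comp_apply, F, DirectSum.lmap_lof, DirectSum.coeLinearMap_lof]
      rfl
    refine LinearMap.ext fun x => ?_
    have h' := LinearMap.congr_fun h (DirectSum.decomposeLinearEquiv (kunneth 𝒜 ℬ) (e x))
    refine h'.trans ?_
    have h'' : DirectSum.coeLinearMap (kunneth 𝒜 ℬ)
        (DirectSum.decomposeLinearEquiv (kunneth 𝒜 ℬ) (e x)) = e x :=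
      (DirectSum.decomposeLinearEquiv (kunneth 𝒜 ℬ)).symm_apply_apply (e x)
    rw [LinearMap.comp_apply, h'']
    exact e.symm_apply_apply x
  · refine DirectSum.linearMap_ext k fun n => LinearMap.ext fun x => ?_
    simp only [LinearMap.comp_apply, DirectSum.coeLinearMap_lof, LinearEquiv.coe_coe,
      DirectSum.decomposeLinearEquiv_apply]
    rw [DirectSum.decompose_of_mem (kunneth 𝒜 ℬ) (τ.mem_grading.1 x.2)]
    exact DirectSum.lmap_lof _ _ _

/-- `A ⊗_τ B` is a graded algebra. -/
instance {𝒜 : ℕ → Submodule k A} {ℬ : ℕ → Submodule k B} [GradedAlgebra 𝒜] [GradedAlgebra ℬ]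
    (τ : GradedTwistingMap 𝒜 ℬ) : GradedAlgebra τ.grading where
  toDecomposition := τ.decomposition
  one_mem := by
    change TwistedTensorProduct.toTensor τ.toTwistingMap 1 ∈ kunneth 𝒜 ℬ 0
    rw [TwistedTensorProduct.toTensor_one]
    exact tmul_mem_kunneth (p := 0) (q := 0) (SetLike.one_mem_graded 𝒜)
      (SetLike.one_mem_graded ℬ)
  mul_mem _ _ x y hx hy := by
    change TwistedTensorProduct.toTensor _ (x * y) ∈ kunneth 𝒜 ℬ _
    rw [TwistedTensorProduct.toTensor_mul]
    exact τ.twistedMul_mem hx hy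

end Twisting

/-! ### Quadratic and Koszul algebras -/

section Koszul

variable {k R : Type*} [Field k] [Ring R] [Algebra k R]

/-- A graded algebra is connected if its degree zero component is one-dimensional. -/
def IsConnectedGraded (𝒜 : ℕ → Submodule k R) : Prop := Module.finrank k (𝒜 0) = 1

/-- A graded algebra is locally finite dimensional if its components are finite dimensional. -/
def IsLocallyFinite (𝒜 : ℕ → Submodule k R) : Prop := ∀ i : ℕ, FiniteDimensional k (𝒜 i)

/-- The canonical multiplication map `π : T(R_1) → R`. -/
def canonicalMap (𝒜 : ℕ → Submodule k R) : TensorAlgebra k (𝒜 1) →ₐ[k] R :=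
  TensorAlgebra.lift k (𝒜 1).subtype

/-- A graded algebra is one-generated if `π : T(R_1) → R` is surjective. -/
def IsOneGenerated (𝒜 : ℕ → Submodule k R) : Prop := Function.Surjective (canonicalMap 𝒜)

/-- The two-sided ideal `⟨ker π ∩ (R_1 ⊗ R_1)⟩` of `T(R_1)`; here `R_1 ⊗ R_1` is the component of
degree two of the tensor algebra. -/
def quadraticRelations (𝒜 : ℕ → Submodule k R) : TwoSidedIdeal (TensorAlgebra k (𝒜 1)) :=
  TwoSidedIdeal.span {x | canonicalMap 𝒜 x = 0 ∧
    x ∈ LinearMap.range (TensorAlgebra.ι k (M := 𝒜 1)) ^ 2}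

/-- A quadratic algebra: a connected, locally finite dimensional graded algebra that is
one-generated and whose relations are generated in degree two, that is, `π` induces an isomorphism
from the quadratic part `T(R_1) / ⟨ker π ∩ (R_1 ⊗ R_1)⟩` to `R`. -/
structure IsQuadratic (𝒜 : ℕ → Submodule k R) [GradedAlgebra 𝒜] : Prop where
  connected : IsConnectedGraded 𝒜
  locallyFinite : IsLocallyFinite 𝒜
  oneGenerated : IsOneGenerated 𝒜
  ker_eq : TwoSidedIdeal.ker (canonicalMap 𝒜) = quadraticRelations 𝒜

/-- The component of degree `n` of the graded free left `R`-module with a basis indexed by `ι` and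
placed in degree `m`: the families with entries in `R_{n-m}`, which is zero if `n < m`. -/
def freeGrading (𝒜 : ℕ → Submodule k R) (ι : Type*) (m n : ℕ) : Submodule k (ι →₀ R) :=
  Finsupp.submodule fun _ : ι => if m ≤ n then 𝒜 (n - m) else ⊥

/-- A resolution `⋯ → P_2 → P_1 → P_0 → R / R_+ → 0` of the trivial left module by graded free left
modules and graded maps, where `P_i` is generated in degree `i`: it is the free module on a basis
`ι i`, graded so that the basis has degree `i`. (As `R / R_+` is concentrated in degree zero and
`R_+` annihilates it, the augmentation `ε` is automatically graded.) -/
structure LinearFreeResolution (𝒜 : ℕ → Submodule k R) [GradedAlgebra 𝒜] where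
  /-- The basis of `P_i`. -/
  ι : ℕ → Type
  /-- The differential `P_{i+1} → P_i`. -/
  d : ∀ i : ℕ, (ι (i + 1) →₀ R) →ₗ[R] (ι i →₀ R)
  /-- The augmentation `P_0 → R / R_+`. -/
  ε : (ι 0 →₀ R) →ₗ[R] R ⧸ (HomogeneousIdeal.irrelevant 𝒜).toIdeal
  d_graded : ∀ i n : ℕ, ∀ x ∈ freeGrading 𝒜 (ι (i + 1)) (i + 1) n,
    d i x ∈ freeGrading 𝒜 (ι i) i n
  ε_surjective : Function.Surjective ε
  exact_zero : Function.Exact (d 0) ε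
  exact_succ : ∀ i : ℕ, Function.Exact (d (i + 1)) (d i)

/-- A Koszul algebra: a connected, locally finite dimensional graded algebra whose trivial module
has a resolution by graded free left modules `P_i` generated in degree `i`. -/
structure IsKoszul (𝒜 : ℕ → Submodule k R) [GradedAlgebra 𝒜] : Prop where
  connected : IsConnectedGraded 𝒜
  locallyFinite : IsLocallyFinite 𝒜
  exists_resolution : Nonempty (LinearFreeResolution 𝒜)

end Koszul

end TwistedKoszul

end

/-!
Write `C` for the twisted tensor product of `A` and `B`; as a vector space it is `A ⊗ B`.

*Koszulness.* Suppose first that `τ(B_+ ⊗ A_+) ⊆ A ⊗ B_+`. Then `A ⊗ B_+` is a two-sided ideal of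
`C`, so that `C → A` is a map of graded algebras, and `C` is free as a right module over `B`
(`SplitFactorization`). Inducing the resolution of the trivial `B`-module to `C` resolves `A` as a
`C`-module, and the resolution of the trivial `A`-module is then replaced, step by step, by a
resolution over `C`. This is organized through syzygies: a submodule of a free module is linearly
resolved (`IsLinearlyResolved`) if it lies in a class of submodules each of which is covered by a
matrix with entries of degree one, with kernel in the class. Over `C`, such a class is formed by the
iterated extensions of pullbacks of `A`-syzygies and of syzygies induced from `B`; it is closed
under syzygies by the horseshoe lemma (`ExtensionClosure.hasLinearCover`,
`SplitFactorization.hasLinearCover_of_isBuildingBlock`).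

If `τ(B_+ ⊗ A_+) ⊆ A_+ ⊗ B` instead, the opposite algebras are in the first situation, with the
roles of `A` and `B` exchanged. It remains to see that Koszulness passes to the opposite algebra
(`GradedAntiEquiv.isLinearlyResolved`). A linear resolution of the trivial left module computes
`Tor(N, k)` for right modules `N`. For `N = R_+` these groups are diagonal, and the minimal cover of
a module with diagonal `Tor` is linear, with a kernel that again has diagonal `Tor`
(`GradedAntiEquiv.IsTorLinear.hasLinearCover`).

*Quadraticity.* Let `V` and `W` be the copies of `A_1` and `B_1` in `C_1`, so that `C_1 = V ⊕ W`. If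
`τ` is one-sided, then each product `w v` is congruent, modulo the quadratic relations of `C`, to an
element of `V (V + W)`, or each is congruent to an element of `(V + W) W`
(`GradedTwistingMap.letters_mul_le_left`, `GradedTwistingMap.letters_mul_le_right`). In either case,
every word in `V + W` can be straightened to a combination of products of a word in `V` with a word
in `W` (`sup_pow_le_mul`). So a relation of `C` is congruent to an element of `T(A_1) ⊗ T(B_1)` in
the kernel of the surjection onto `A ⊗ B`. That kernel is generated by the kernels for `A` and for `B`,
which consist of consequences of quadratic relations.
-/

open scoped TensorProduct DirectSum

noncomputable section

namespace TwistedKoszul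

/-! ### Linearly resolved submodules of free modules -/

section LinearCovers

variable {k R : Type*} [Field k] [Ring R] [Algebra k R]

/-- The vectors of the free module `R^(ι)` all of whose coordinates are homogeneous of degree
`m`. -/
def coordDegree (𝒜 : ℕ → Submodule k R) (ι : Type*) (m : ℕ) : Submodule k (ι →₀ R) :=
  Finsupp.submodule fun _ : ι => 𝒜 m

theorem linearCombination_apply_apply {ι ι' : Type*} (D : ι' → ι →₀ R) (x : ι' →₀ R) (b : ι) :
    Finsupp.linearCombination R D x b = x.sum fun a r => r * D a b := by
  rw [Finsupp.linearCombination_apply, Finsupp.sum_apply]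
  simp

theorem linearCombination_mem_coordDegree {𝒜 : ℕ → Submodule k R} [SetLike.GradedMonoid 𝒜]
    {ι ι' : Type*} {D : ι' → ι →₀ R} (hD : ∀ a, D a ∈ coordDegree 𝒜 ι 1) {m : ℕ} {x : ι' →₀ R}
    (hx : x ∈ coordDegree 𝒜 ι' m) :
    Finsupp.linearCombination R D x ∈ coordDegree 𝒜 ι (m + 1) := by
  intro b
  rw [linearCombination_apply_apply]
  exact Submodule.sum_mem _ fun a _ =>
    SetLike.mul_mem_graded (hx a) (hD a b)

variable (𝒜 : ℕ → Submodule k R)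

/-- `S` is the image of a matrix with entries in `R_1` whose kernel belongs to the class `𝒮`: this
is the first step of a linear resolution of `S`. -/
def HasLinearCover (𝒮 : ∀ ι : Type, Submodule R (ι →₀ R) → Prop) (ι : Type)
    (S : Submodule R (ι →₀ R)) : Prop :=
  ∃ (ι' : Type) (D : ι' → ι →₀ R), (∀ a, D a ∈ coordDegree 𝒜 ι 1) ∧
    LinearMap.range (Finsupp.linearCombination R D) = S ∧
    𝒮 ι' (LinearMap.ker (Finsupp.linearCombination R D))

/-- `S ⊆ R^(ι)` has an infinite resolution by matrices with entries in `R_1`. The definition is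
coinductive: `S` belongs to a class of submodules of free modules in which every member has a linear
cover with kernel in the class. -/
def IsLinearlyResolved (ι : Type) (S : Submodule R (ι →₀ R)) : Prop :=
  ∃ 𝒮 : ∀ ι : Type, Submodule R (ι →₀ R) → Prop,
    (∀ ι S, 𝒮 ι S → HasLinearCover 𝒜 𝒮 ι S) ∧ 𝒮 ι S

variable {𝒜} in
theorem IsLinearlyResolved.hasLinearCover {ι : Type} {S : Submodule R (ι →₀ R)}
    (h : IsLinearlyResolved 𝒜 ι S) : HasLinearCover 𝒜 (IsLinearlyResolved 𝒜) ι S := by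
  obtain ⟨𝒮, h𝒮, hS⟩ := h
  obtain ⟨ι', D, hD, hr, hk⟩ := h𝒮 ι S hS
  exact ⟨ι', D, hD, hr, 𝒮, h𝒮, hk⟩

variable [GradedAlgebra 𝒜]

/-- The coordinatewise projection of the free module `R^(ι)` to its vectors of degree `m`. -/
def coordProj (ι : Type*) (m : ℕ) : (ι →₀ R) →ₗ[k] (ι →₀ R) :=
  Finsupp.mapRange.linearMap (GradedAlgebra.proj 𝒜 m)

theorem coordProj_apply {ι : Type*} (m : ℕ) (x : ι →₀ R) (a : ι) :
    coordProj 𝒜 ι m x a = DirectSum.decompose 𝒜 (x a) m := rfl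

theorem coordProj_mem {ι : Type*} (m : ℕ) (x : ι →₀ R) :
    coordProj 𝒜 ι m x ∈ coordDegree 𝒜 ι m := fun _ => SetLike.coe_mem _

theorem coordProj_of_mem {ι : Type*} {m : ℕ} {x : ι →₀ R} (hx : x ∈ coordDegree 𝒜 ι m) :
    coordProj 𝒜 ι m x = x := by
  ext a
  exact DirectSum.decompose_of_mem_same 𝒜 (hx a)

theorem coordProj_linearCombination {ι ι' : Type*} {D : ι' → ι →₀ R}
    (hD : ∀ a, D a ∈ coordDegree 𝒜 ι 1) (m : ℕ) (x : ι' →₀ R) :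
    coordProj 𝒜 ι (m + 1) (Finsupp.linearCombination R D x) =
      Finsupp.linearCombination R D (coordProj 𝒜 ι' m x) := by
  induction x using Finsupp.induction_linear with
  | zero => simp
  | add x y hx hy => simp only [map_add, hx, hy]
  | single a r =>
    have h : coordProj 𝒜 ι' m (Finsupp.single a r) =
        Finsupp.single a (DirectSum.decompose 𝒜 r m : R) := by
      simp [coordProj, GradedAlgebra.proj_apply]
    rw [h, Finsupp.linearCombination_single, Finsupp.linearCombination_single]
    ext b
    simp only [coordProj_apply, Finsupp.smul_apply, smul_eq_mul]
    exact DirectSum.coe_decompose_mul_add_of_right_mem 𝒜 (hD a b)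

theorem exists_sum_coordProj {ι : Type*} (x : ι →₀ R) :
    ∃ s : Finset ℕ, ∑ m ∈ s, coordProj 𝒜 ι m x = x := by
  classical
  refine ⟨x.support.biUnion fun a => (DirectSum.decompose 𝒜 (x a)).support, ?_⟩
  ext a
  rw [Finsupp.finsetSum_apply]
  simp only [coordProj_apply]
  by_cases ha : a ∈ x.support
  · rw [← Finset.sum_subset (Finset.subset_biUnion_of_mem _ ha)]
    · exact DirectSum.sum_support_decompose 𝒜 (x a)
    · intro m _ hm
      rw [DFinsupp.notMem_support_iff.1 hm]
      rfl
  · rw [Finsupp.notMem_support_iff.1 ha]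
    simp

/-- A submodule of a free module is graded if it contains the homogeneous components of its
elements, for the grading which places the basis in degree zero. -/
def IsCoordGraded {ι : Type*} (S : Submodule R (ι →₀ R)) : Prop :=
  ∀ m, ∀ x ∈ S, coordProj 𝒜 ι m x ∈ S

theorem isCoordGraded_ker {ι ι' : Type*} {D : ι' → ι →₀ R}
    (hD : ∀ a, D a ∈ coordDegree 𝒜 ι 1) :
    IsCoordGraded 𝒜 (LinearMap.ker (Finsupp.linearCombination R D)) := by
  intro m x hx
  rw [LinearMap.mem_ker] at hx ⊢
  rw [← coordProj_linearCombination 𝒜 hD, hx, map_zero]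

/-- The augmentation ideal `R_+`, as a submodule of the free module of rank one. -/
def augmentation : Submodule R (Unit →₀ R) :=
  Submodule.comap (Finsupp.lapply (R := R) ()) (HomogeneousIdeal.irrelevant 𝒜).toIdeal

theorem mem_irrelevant {r : R} :
    r ∈ (HomogeneousIdeal.irrelevant 𝒜).toIdeal ↔ (DirectSum.decompose 𝒜 r 0 : R) = 0 :=
  HomogeneousIdeal.mem_irrelevant_iff 𝒜 r

theorem mem_augmentation {x : Unit →₀ R} :
    x ∈ augmentation 𝒜 ↔ x () ∈ (HomogeneousIdeal.irrelevant 𝒜).toIdeal := Iff.rfl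

theorem mem_irrelevant_of_mem {r : R} {m : ℕ} (hm : 0 < m) (hr : r ∈ 𝒜 m) :
    r ∈ (HomogeneousIdeal.irrelevant 𝒜).toIdeal :=
  HomogeneousIdeal.mem_irrelevant_of_mem 𝒜 hm hr

end LinearCovers

section Connected

variable {k R : Type*} [Field k] [Ring R] [Algebra k R] {𝒜 : ℕ → Submodule k R}

theorem IsConnectedGraded.nontrivial (h : IsConnectedGraded 𝒜) : Nontrivial R := by
  by_contra hR
  rw [not_nontrivial_iff_subsingleton] at hR
  have : Module.finrank k (𝒜 0) = 0 := Module.finrank_zero_of_subsingleton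
  rw [IsConnectedGraded, this] at h
  exact zero_ne_one h

variable [GradedAlgebra 𝒜]

theorem IsConnectedGraded.exists_algebraMap (h : IsConnectedGraded 𝒜) {r : R} (hr : r ∈ 𝒜 0) :
    ∃ c : k, algebraMap k R c = r := by
  have := h.nontrivial
  have h1 : (⟨1, SetLike.one_mem_graded 𝒜⟩ : 𝒜 0) ≠ 0 := fun e =>
    one_ne_zero (congrArg Subtype.val e)
  obtain ⟨c, hc⟩ := (finrank_eq_one_iff_of_nonzero' _ h1).1 h ⟨r, hr⟩
  exact ⟨c, by rw [Algebra.algebraMap_eq_smul_one]; exact congrArg Subtype.val hc⟩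

theorem IsConnectedGraded.algebraMap_mem_irrelevant (h : IsConnectedGraded 𝒜) {c : k}
    (hc : algebraMap k R c ∈ (HomogeneousIdeal.irrelevant 𝒜).toIdeal) : c = 0 := by
  have := h.nontrivial
  rw [mem_irrelevant, DirectSum.decompose_of_mem_same 𝒜 (SetLike.algebraMap_mem_graded 𝒜 c)] at hc
  exact (map_eq_zero_iff _ (algebraMap k R).injective).1 hc

theorem IsConnectedGraded.exists_mk_algebraMap (h : IsConnectedGraded 𝒜)
    (q : R ⧸ (HomogeneousIdeal.irrelevant 𝒜).toIdeal) :
    ∃ c : k, Submodule.Quotient.mk (algebraMap k R c) = q := by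
  obtain ⟨r, rfl⟩ := Submodule.Quotient.mk_surjective _ q
  obtain ⟨c, hc⟩ := h.exists_algebraMap (SetLike.coe_mem (DirectSum.decompose 𝒜 r 0))
  refine ⟨c, ?_⟩
  rw [hc, Submodule.Quotient.eq, mem_irrelevant]
  rw [DirectSum.decompose_sub, DirectSum.sub_apply, AddSubgroupClass.coe_sub,
    DirectSum.decompose_of_mem_same 𝒜 (SetLike.coe_mem _), sub_self]

end Connected

section Resolutions

variable {k R : Type*} [Field k] [Ring R] [Algebra k R] {𝒜 : ℕ → Submodule k R}
  [GradedAlgebra 𝒜]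

namespace LinearFreeResolution

variable (L : LinearFreeResolution 𝒜)

/-- The matrix of the differential `P_{i+1} → P_i`. -/
def matrix (i : ℕ) (a : L.ι (i + 1)) : L.ι i →₀ R := L.d i (Finsupp.single a 1)

theorem linearCombination_matrix (i : ℕ) : Finsupp.linearCombination R (L.matrix i) = L.d i := by
  refine Finsupp.lhom_ext fun a r => ?_
  rw [Finsupp.linearCombination_single, matrix, ← map_smul, Finsupp.smul_single, smul_eq_mul,
    mul_one]

theorem matrix_mem (i : ℕ) (a : L.ι (i + 1)) : L.matrix i a ∈ coordDegree 𝒜 (L.ι i) 1 := by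
  have h := L.d_graded i (i + 1) (Finsupp.single a 1) (by
    intro b
    simp only [le_refl, if_true, Nat.sub_self]
    classical
    rw [Finsupp.single_apply]
    split_ifs
    · exact SetLike.one_mem_graded 𝒜
    · exact zero_mem _)
  intro b
  have hb := h b
  rwa [if_pos (Nat.le_succ i), show i + 1 - i = 1 by omega] at hb

theorem apply_mem_irrelevant {x : L.ι 0 →₀ R} (hx : L.ε x = 0) (a : L.ι 0) :
    x a ∈ (HomogeneousIdeal.irrelevant 𝒜).toIdeal := by
  obtain ⟨w, rfl⟩ := (L.exact_zero x).1 hx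
  rw [← L.linearCombination_matrix, linearCombination_apply_apply]
  exact Submodule.sum_mem _ fun b _ => Ideal.mul_mem_left _ _
    (mem_irrelevant_of_mem 𝒜 one_pos (L.matrix_mem 0 b a))

/-- Over a connected algebra, `P_0` has rank one. -/
theorem exists_unique_index (h : IsConnectedGraded 𝒜) : ∃ a : L.ι 0, ∀ b, b = a := by
  have key : ∀ a : L.ι 0, ∃ c : k, c ≠ 0 ∧
      L.ε (Finsupp.single a 1) = Submodule.Quotient.mk (algebraMap k R c) := by
    intro a
    obtain ⟨c, hc⟩ := h.exists_mk_algebraMap (L.ε (Finsupp.single a 1))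
    refine ⟨c, ?_, hc.symm⟩
    rintro rfl
    rw [map_zero, Submodule.Quotient.mk_zero] at hc
    have h1 := L.apply_mem_irrelevant hc.symm a
    rw [Finsupp.single_eq_same, ← map_one (algebraMap k R)] at h1
    exact one_ne_zero (h.algebraMap_mem_irrelevant h1)
  have hne : Nonempty (L.ι 0) := by
    by_contra hn
    rw [not_nonempty_iff] at hn
    obtain ⟨x, hx⟩ := L.ε_surjective (Submodule.Quotient.mk 1)
    rw [Subsingleton.elim x 0, map_zero] at hx
    have h1 := (Submodule.Quotient.mk_eq_zero _).1 hx.symm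
    rw [← map_one (algebraMap k R)] at h1
    exact one_ne_zero (h.algebraMap_mem_irrelevant h1)
  obtain ⟨a⟩ := hne
  refine ⟨a, fun b => ?_⟩
  by_contra hab
  obtain ⟨s, hs, hsa⟩ := key a
  obtain ⟨t, ht, htb⟩ := key b
  have hsm : ∀ (u v : k) (e : L.ι 0),
      L.ε (Finsupp.single e 1) = Submodule.Quotient.mk (algebraMap k R v) →
      L.ε (Finsupp.single e (algebraMap k R u)) =
        Submodule.Quotient.mk (algebraMap k R (u * v)) := by
    intro u v e he
    have : Finsupp.single e (algebraMap k R u) = algebraMap k R u • Finsupp.single e (1 : R) := by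
      rw [Finsupp.smul_single, smul_eq_mul, mul_one]
    rw [this, map_smul, he, ← Submodule.Quotient.mk_smul, smul_eq_mul, map_mul]
  have hz :
      L.ε (Finsupp.single a (algebraMap k R t) - Finsupp.single b (algebraMap k R s)) = 0 := by
    rw [map_sub, hsm t s a hsa, hsm s t b htb, mul_comm, sub_self]
  have h1 := L.apply_mem_irrelevant hz a
  rw [Finsupp.sub_apply, Finsupp.single_eq_same, Finsupp.single_eq_of_ne (Ne.symm hab),
    sub_zero] at h1
  exact ht (h.algebraMap_mem_irrelevant h1)

theorem ε_eq_zero_iff (h : IsConnectedGraded 𝒜) {x : L.ι 0 →₀ R} :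
    L.ε x = 0 ↔ ∀ a, x a ∈ (HomogeneousIdeal.irrelevant 𝒜).toIdeal := by
  refine ⟨fun hx => L.apply_mem_irrelevant hx, fun hx => ?_⟩
  obtain ⟨a, ha⟩ := L.exists_unique_index h
  obtain ⟨c, hc⟩ := h.exists_mk_algebraMap (L.ε (Finsupp.single a 1))
  have hxa : x = x a • Finsupp.single a (1 : R) := by
    ext b
    rw [ha b]
    simp
  rw [hxa, map_smul, ← hc, ← Submodule.Quotient.mk_smul, Submodule.Quotient.mk_eq_zero,
    smul_eq_mul, ← Algebra.commutes]
  exact Ideal.mul_mem_left _ _ (hx a)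

/-- The syzygies of a linear free resolution of the trivial module, with `P_0` identified with the
free module on one generator. -/
inductive IsSyzygy : ∀ ι : Type, Submodule R (ι →₀ R) → Prop
  | augmentation : IsSyzygy Unit (augmentation 𝒜)
  | ker (i : ℕ) : IsSyzygy (L.ι (i + 1)) (LinearMap.ker (L.d i))

end LinearFreeResolution

/-- The resolution of the trivial module can be taken with `P_0 = R`, so its first syzygy is
`R_+`. -/
theorem IsKoszul.isLinearlyResolved (h : IsKoszul 𝒜) :
    IsLinearlyResolved 𝒜 Unit (augmentation 𝒜) := by
  obtain ⟨L⟩ := h.exists_resolution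
  refine ⟨L.IsSyzygy, ?_, .augmentation⟩
  rintro ι S (_ | i)
  · obtain ⟨a, ha⟩ := L.exists_unique_index h.connected
    have e : L.ι 0 ≃ Unit := ⟨fun _ => (), fun _ => a, fun b => (ha b).symm, fun _ => rfl⟩
    let E : (L.ι 0 →₀ R) ≃ₗ[R] (Unit →₀ R) := Finsupp.domLCongr e
    have hE : ∀ x u, E x u = x a := by
      intro x u
      change x (e.symm u) = x a
      rw [ha (e.symm u)]
    have hlc : Finsupp.linearCombination R (fun b => E (L.matrix 0 b)) =
        E.toLinearMap ∘ₗ L.d 0 := by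
      rw [← L.linearCombination_matrix]
      refine Finsupp.lhom_ext fun b r => ?_
      simp
    refine ⟨L.ι 1, fun b => E (L.matrix 0 b), fun b u => ?_, ?_, ?_⟩
    · rw [hE]; exact L.matrix_mem 0 b a
    · rw [hlc]
      ext x
      rw [mem_augmentation, ← E.apply_symm_apply x, hE]
      have : E.symm x a ∈ (HomogeneousIdeal.irrelevant 𝒜).toIdeal ↔ L.ε (E.symm x) = 0 := by
        rw [L.ε_eq_zero_iff h.connected]
        exact ⟨fun hx b => by rwa [ha b], fun hx => hx a⟩
      rw [this, L.exact_zero]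
      simp [← LinearEquiv.eq_symm_apply]
    · rw [hlc, LinearEquiv.ker_comp]
      exact .ker 0
  · refine ⟨L.ι (i + 2), L.matrix (i + 1), L.matrix_mem (i + 1), ?_, ?_⟩
    · rw [L.linearCombination_matrix]
      exact (LinearMap.exact_iff.1 (L.exact_succ i)).symm
    · rw [L.linearCombination_matrix]
      exact .ker (i + 1)

/-- The resolution is built by iterating the choice of a linear cover. -/
theorem IsLinearlyResolved.nonempty_linearFreeResolution
    (h : IsLinearlyResolved 𝒜 Unit (augmentation 𝒜)) : Nonempty (LinearFreeResolution 𝒜) := by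
  let State := Σ ι : Type, {S : Submodule R (ι →₀ R) // IsLinearlyResolved 𝒜 ι S}
  have step : ∀ s : State, ∃ (t : State) (D : t.1 → s.1 →₀ R),
      (∀ a, D a ∈ coordDegree 𝒜 s.1 1) ∧
      LinearMap.range (Finsupp.linearCombination R D) = s.2.1 ∧
      LinearMap.ker (Finsupp.linearCombination R D) = t.2.1 := by
    rintro ⟨ι, S, hS⟩
    obtain ⟨ι', D, hD, hr, hk⟩ := hS.hasLinearCover
    exact ⟨⟨ι', _, hk⟩, D, hD, hr, rfl⟩
  choose next D hD hr hk using step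
  let state : ℕ → State := fun i => Nat.rec ⟨Unit, _, h⟩ (fun _ s => next s) i
  refine ⟨⟨fun i => (state i).1, fun i => Finsupp.linearCombination R (D (state i)),
    (HomogeneousIdeal.irrelevant 𝒜).toIdeal.mkQ ∘ₗ Finsupp.lapply (R := R) (), ?_, ?_, ?_, ?_⟩⟩
  · intro i n x hx b
    by_cases hin : i + 1 ≤ n
    · have hx' : x ∈ coordDegree 𝒜 (state (i + 1)).1 (n - (i + 1)) := fun a => by
        have := hx a
        rwa [if_pos hin] at this
      have := linearCombination_mem_coordDegree (hD (state i)) hx' b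
      rw [if_pos (by omega)]
      rwa [show n - (i + 1) + 1 = n - i by omega] at this
    · have : x = 0 := by
        ext a
        have := hx a
        rwa [if_neg hin, Submodule.mem_bot] at this
      rw [this, map_zero]
      exact zero_mem _
  · refine (Submodule.mkQ_surjective _).comp fun r => ⟨Finsupp.single () r, ?_⟩
    simp
  · rw [LinearMap.exact_iff, hr (state 0), LinearMap.ker_comp, Submodule.ker_mkQ]
    rfl
  · intro i
    rw [LinearMap.exact_iff, hk (state i)]
    exact (hr (state (i + 1))).symm

end Resolutions

/-! ### Linear covers and extensions -/

section Extensions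

variable {k R : Type*} [Field k] [Ring R] [Algebra k R]

theorem sumElim_mem_coordDegree {𝒜 : ℕ → Submodule k R} {ι κ : Type*} {m : ℕ} {x : ι →₀ R}
    {y : κ →₀ R} (hx : x ∈ coordDegree 𝒜 ι m) (hy : y ∈ coordDegree 𝒜 κ m) :
    x.sumElim y ∈ coordDegree 𝒜 (ι ⊕ κ) m
  | .inl a => hx a
  | .inr b => hy b

theorem exists_eq_sumElim {ι κ : Type*} (z : ι ⊕ κ →₀ R) :
    ∃ (x : ι →₀ R) (y : κ →₀ R), z = x.sumElim y :=
  ⟨_, _, (Finsupp.comapDomain_sumElim_comapDomain z).symm⟩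

theorem linearCombination_sumElim {ι ι' κ : Type*} (D : ι → κ →₀ R) (E : ι' → κ →₀ R)
    (x : ι →₀ R) (y : ι' →₀ R) :
    Finsupp.linearCombination R (Sum.elim D E) (x.sumElim y) =
      Finsupp.linearCombination R D x + Finsupp.linearCombination R E y := by
  rw [Finsupp.sumElim_eq_add, map_add, Finsupp.linearCombination_mapDomain,
    Finsupp.linearCombination_mapDomain]
  rfl

theorem linearCombination_sumElim_right {ι κ κ' : Type*} (D : ι → κ →₀ R) (E : ι → κ' →₀ R)
    (x : ι →₀ R) :
    Finsupp.linearCombination R (fun a => (D a).sumElim (E a)) x =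
      (Finsupp.linearCombination R D x).sumElim (Finsupp.linearCombination R E x) := by
  ext (a | b) <;> simp [linearCombination_apply_apply]

variable (𝒜 : ℕ → Submodule k R) [GradedAlgebra 𝒜]

theorem coordProj_sumElim {ι κ : Type*} (m : ℕ) (x : ι →₀ R) (y : κ →₀ R) :
    coordProj 𝒜 (ι ⊕ κ) m (x.sumElim y) = (coordProj 𝒜 ι m x).sumElim (coordProj 𝒜 κ m y) := by
  ext (a | b) <;> rfl

/-- The closure of a class of submodules of free modules under extensions: a graded submodule
`L ⊆ R^(ι) ⊕ R^(κ)` is the extension of its projection `L''` to `R^(κ)` by its intersection `L'`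
with `R^(ι)`. -/
inductive ExtensionClosure (𝒮 : ∀ ι : Type, Submodule R (ι →₀ R) → Prop) :
    ∀ ι : Type, Submodule R (ι →₀ R) → Prop
  | base {ι : Type} {S : Submodule R (ι →₀ R)} : 𝒮 ι S → ExtensionClosure 𝒮 ι S
  | extension {ι κ : Type} {L : Submodule R (ι ⊕ κ →₀ R)} {L' : Submodule R (ι →₀ R)}
      {L'' : Submodule R (κ →₀ R)} :
      IsCoordGraded 𝒜 L → (∀ x, x ∈ L' ↔ Finsupp.sumElim x 0 ∈ L) →
      (∀ y, y ∈ L'' ↔ ∃ x, Finsupp.sumElim x y ∈ L) →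
      ExtensionClosure 𝒮 ι L' → ExtensionClosure 𝒮 κ L'' → ExtensionClosure 𝒮 (ι ⊕ κ) L

variable {𝒜}

/-- The horseshoe lemma for linear covers. -/
theorem ExtensionClosure.hasLinearCover {𝒮 : ∀ ι : Type, Submodule R (ι →₀ R) → Prop}
    (h𝒮 : ∀ ι S, 𝒮 ι S → HasLinearCover 𝒜 (ExtensionClosure 𝒜 𝒮) ι S) {ι : Type}
    {S : Submodule R (ι →₀ R)} (hS : ExtensionClosure 𝒜 𝒮 ι S) :
    HasLinearCover 𝒜 (ExtensionClosure 𝒜 𝒮) ι S := by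
  induction hS with
  | base h => exact h𝒮 _ _ h
  | @extension ι κ L L' L'' hL hL' hL'' _ _ ih' ih'' =>
    obtain ⟨ι', D', hD', hr', hk'⟩ := ih'
    obtain ⟨κ', D'', hD'', hr'', hk''⟩ := ih''
    -- Since `L` is graded, the generators of `L''` lift to `L` with homogeneous coordinates.
    have hu : ∀ a, ∃ u ∈ coordDegree 𝒜 ι 1, u.sumElim (D'' a) ∈ L := by
      intro a
      have ha : D'' a ∈ L'' := by
        rw [← hr'']
        exact ⟨Finsupp.single a 1, by simp⟩
      obtain ⟨x, hx⟩ := (hL'' _).1 ha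
      refine ⟨_, coordProj_mem 𝒜 1 x, ?_⟩
      have := hL 1 _ hx
      rwa [coordProj_sumElim, coordProj_of_mem 𝒜 (hD'' a)] at this
    choose u hu huL using hu
    let D : ι' ⊕ κ' → ι ⊕ κ →₀ R :=
      Sum.elim (fun b => (D' b).sumElim 0) (fun a => (u a).sumElim (D'' a))
    have hD : ∀ a, D a ∈ coordDegree 𝒜 (ι ⊕ κ) 1
      | .inl b => sumElim_mem_coordDegree (hD' b) (zero_mem _)
      | .inr a => sumElim_mem_coordDegree (hu a) (hD'' a)
    have hlc : ∀ x y, Finsupp.linearCombination R D (x.sumElim y) =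
        (Finsupp.linearCombination R D' x + Finsupp.linearCombination R u y).sumElim
          (Finsupp.linearCombination R D'' y) := by
      intro x y
      rw [linearCombination_sumElim, linearCombination_sumElim_right D' (fun _ => 0),
        linearCombination_sumElim_right, ← Finsupp.sumElim_add]
      congr 1
      have : Finsupp.linearCombination R (fun _ : ι' => (0 : κ →₀ R)) x = 0 := by
        simp [Finsupp.linearCombination_apply]
      rw [this, zero_add]
    have hDL : ∀ z, Finsupp.linearCombination R D z ∈ L := by
      intro z
      rw [Finsupp.linearCombination_apply]
      refine Submodule.sum_mem _ fun a _ => L.smul_mem _ ?_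
      rcases a with b | a
      · refine (hL' _).1 ?_
        rw [← hr']
        exact ⟨Finsupp.single b 1, by simp⟩
      · exact huL a
    refine ⟨ι' ⊕ κ', D, hD, le_antisymm ?_ ?_, .extension (isCoordGraded_ker 𝒜 hD) ?_ ?_ hk' hk''⟩
    · rintro _ ⟨z, rfl⟩
      exact hDL z
    · intro z hz
      obtain ⟨z₁, z₂, rfl⟩ := exists_eq_sumElim z
      have h₂ : z₂ ∈ LinearMap.range (Finsupp.linearCombination R D'') := by
        rw [hr'']
        exact (hL'' _).2 ⟨_, hz⟩
      obtain ⟨y, rfl⟩ := h₂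
      have h₁ := L.sub_mem hz (hDL ((0 : ι' →₀ R).sumElim y))
      have h₁' : z₁ - Finsupp.linearCombination R u y ∈ L' := by
        rw [hL']
        convert h₁ using 1
        rw [hlc]
        ext (a | b) <;> simp
      rw [← hr'] at h₁'
      obtain ⟨x, hx⟩ := h₁'
      exact ⟨x.sumElim y, by rw [hlc, hx, sub_add_cancel]⟩
    · intro x
      rw [LinearMap.mem_ker, LinearMap.mem_ker, hlc, map_zero, map_zero, add_zero]
      refine ⟨fun h => by rw [h, Finsupp.sumElim_zero_zero], fun h => ?_⟩
      ext a
      exact DFunLike.congr_fun h (Sum.inl a)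
    · intro y
      constructor
      · intro hy
        rw [LinearMap.mem_ker] at hy
        have h := hDL ((0 : ι' →₀ R).sumElim y)
        rw [hlc, hy, ← hL', ← hr', map_zero, zero_add] at h
        obtain ⟨x, hx⟩ := h
        refine ⟨-x, ?_⟩
        rw [LinearMap.mem_ker, hlc, hy, map_neg, hx, neg_add_cancel, Finsupp.sumElim_zero_zero]
      · rintro ⟨x, hx⟩
        rw [LinearMap.mem_ker, hlc] at hx
        ext a
        exact DFunLike.congr_fun hx (Sum.inr a)

end Extensions

theorem decompose_map {k R R' : Type*} [Field k] [Ring R] [Algebra k R] [Ring R'] [Algebra k R']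
    {𝒜 : ℕ → Submodule k R} [DirectSum.Decomposition 𝒜] {𝒜' : ℕ → Submodule k R'}
    [DirectSum.Decomposition 𝒜'] (φ : R →ₗ[k] R') (hφ : ∀ m, ∀ x ∈ 𝒜 m, φ x ∈ 𝒜' m) (x : R)
    (m : ℕ) : (DirectSum.decompose 𝒜' (φ x) m : R') = φ (DirectSum.decompose 𝒜 x m : R) := by
  induction x using DirectSum.Decomposition.inductionOn 𝒜 with
  | zero => simp
  | add x y hx hy => simp [hx, hy]
  | @homogeneous i x =>
    by_cases h : i = m
    · subst h
      rw [DirectSum.decompose_of_mem_same _ x.2, DirectSum.decompose_of_mem_same _ (hφ _ _ x.2)]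
    · rw [DirectSum.decompose_of_mem_ne _ x.2 h, DirectSum.decompose_of_mem_ne _ (hφ _ _ x.2) h,
        map_zero]

/-! ### Linear resolutions over a factorized algebra -/

section Factorization

variable {k A B C : Type*} [Field k] [Ring A] [Algebra k A] [Ring B] [Algebra k B]
  [Ring C] [Algebra k C]

/-- A factorization `C = A B` of a graded algebra into graded subalgebras `A` and `B`, that is, the
multiplication `A ⊗ B → C` is bijective, such that `A B_+` is the kernel of a retraction `C → A` of
graded algebras. -/
structure SplitFactorization (𝒜 : ℕ → Submodule k A) [GradedAlgebra 𝒜] (ℬ : ℕ → Submodule k B)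
    [GradedAlgebra ℬ] (𝒞 : ℕ → Submodule k C) where
  /-- The inclusion of the first factor. -/
  f : A →ₐ[k] C
  /-- The inclusion of the second factor. -/
  g : B →ₐ[k] C
  /-- The retraction onto the first factor. -/
  p : C →ₐ[k] A
  f_mem : ∀ m, ∀ a ∈ 𝒜 m, f a ∈ 𝒞 m
  g_mem : ∀ m, ∀ b ∈ ℬ m, g b ∈ 𝒞 m
  p_mem : ∀ m, ∀ c ∈ 𝒞 m, p c ∈ 𝒜 m
  bijective : Function.Bijective
    (LinearMap.mul' k C ∘ₗ TensorProduct.map f.toLinearMap g.toLinearMap)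
  p_f : ∀ a, p (f a) = a
  p_g : ∀ b ∈ (HomogeneousIdeal.irrelevant ℬ).toIdeal, p (g b) = 0

namespace SplitFactorization

variable {𝒜 : ℕ → Submodule k A} [GradedAlgebra 𝒜] {ℬ : ℕ → Submodule k B} [GradedAlgebra ℬ]
  {𝒞 : ℕ → Submodule k C} (F : SplitFactorization 𝒜 ℬ 𝒞)

/-- The multiplication isomorphism `A ⊗ B ≃ C`. -/
def mulEquiv : A ⊗[k] B ≃ₗ[k] C := LinearEquiv.ofBijective _ F.bijective

theorem mulEquiv_tmul (a : A) (b : B) : F.mulEquiv (a ⊗ₜ b) = F.f a * F.g b := rfl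

theorem induction_mul {P : C → Prop} (zero : P 0) (mul : ∀ a b, P (F.f a * F.g b))
    (add : ∀ x y, P x → P y → P (x + y)) (c : C) : P c := by
  rw [← F.mulEquiv.apply_symm_apply c]
  induction F.mulEquiv.symm c with
  | zero => rwa [map_zero]
  | tmul a b => exact mul a b
  | add x y hx hy => rw [map_add]; exact add _ _ hx hy

/-- The isomorphism `A^(κ) ⊗ B^(ι) ≃ C^(κ × ι)`. -/
def freeEquiv (κ ι : Type*) : (κ →₀ A) ⊗[k] (ι →₀ B) ≃ₗ[k] (κ × ι →₀ C) :=
  finsuppTensorFinsupp k k A B κ ι ≪≫ₗ Finsupp.mapRange.linearEquiv F.mulEquiv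

theorem freeEquiv_single (κ ι : Type*) (s : κ) (a : A) (t : ι) (b : B) :
    F.freeEquiv κ ι (Finsupp.single s a ⊗ₜ Finsupp.single t b) =
      Finsupp.single (s, t) (F.f a * F.g b) := by
  simp [freeEquiv, mulEquiv_tmul]

theorem freeEquiv_apply (κ ι : Type*) (x : κ →₀ A) (y : ι →₀ B) (s : κ) (t : ι) :
    F.freeEquiv κ ι (x ⊗ₜ y) (s, t) = F.f (x s) * F.g (y t) := by
  simp [freeEquiv, mulEquiv_tmul]

/-- For a matrix `D : B^(ι') → B^(ι)`, the matrix of the map `C^(κ × ι') → C^(κ × ι)` consisting of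
`κ` copies of `C ⊗_B D`. -/
def inducedMatrix (κ : Type*) {ι ι' : Type*} (D : ι' → ι →₀ B) (i : κ × ι') : κ × ι →₀ C :=
  F.freeEquiv κ ι (Finsupp.single i.1 1 ⊗ₜ D i.2)

theorem inducedMatrix_mem (κ : Type*) {ι ι' : Type*} {D : ι' → ι →₀ B}
    (hD : ∀ a, D a ∈ coordDegree ℬ ι 1) (i : κ × ι') :
    F.inducedMatrix κ D i ∈ coordDegree 𝒞 (κ × ι) 1 := by
  classical
  rintro ⟨s, t⟩
  rw [inducedMatrix, freeEquiv_apply, Finsupp.single_apply]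
  split_ifs
  · rw [map_one, one_mul]
    exact F.g_mem _ _ (hD _ t)
  · rw [map_zero, zero_mul]
    exact zero_mem _

/-- Under the isomorphism `C ≃ A ⊗ B`, inducing a matrix from `B` to `C` is tensoring with `A`. -/
theorem linearCombination_inducedMatrix (κ : Type*) {ι ι' : Type*} (D : ι' → ι →₀ B)
    (x : (κ →₀ A) ⊗[k] (ι' →₀ B)) :
    Finsupp.linearCombination C (F.inducedMatrix κ D) (F.freeEquiv κ ι' x) =
      F.freeEquiv κ ι (((Finsupp.linearCombination B D).restrictScalars k).lTensor (κ →₀ A) x) := by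
  classical
  induction x with
  | zero => simp
  | add x y hx hy => simp only [map_add, hx, hy]
  | tmul x y =>
    induction x using Finsupp.induction_linear with
    | zero => simp
    | add x y hx hy => simp only [TensorProduct.add_tmul, map_add, hx, hy]
    | single s a =>
      induction y using Finsupp.induction_linear with
      | zero => simp
      | add x y hx hy => simp only [TensorProduct.tmul_add, map_add, hx, hy]
      | single t b =>
        rw [freeEquiv_single, Finsupp.linearCombination_single, LinearMap.lTensor_tmul,
          LinearMap.restrictScalars_apply, Finsupp.linearCombination_single]
        ext ⟨s', t'⟩
        rw [Finsupp.smul_apply, inducedMatrix, freeEquiv_apply, freeEquiv_apply,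
          Finsupp.smul_apply, smul_eq_mul, smul_eq_mul, Finsupp.single_apply, Finsupp.single_apply]
        split_ifs
        · simp [mul_assoc]
        · simp

theorem ker_inducedMatrix (κ : Type*) {ι ι' ι'' : Type*} {D : ι' → ι →₀ B} {D' : ι'' → ι' →₀ B}
    (h : LinearMap.range (Finsupp.linearCombination B D') =
      LinearMap.ker (Finsupp.linearCombination B D)) :
    LinearMap.range (Finsupp.linearCombination C (F.inducedMatrix κ D')) =
      LinearMap.ker (Finsupp.linearCombination C (F.inducedMatrix κ D)) := by
  have hex : Function.Exact ((Finsupp.linearCombination B D').restrictScalars k)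
      ((Finsupp.linearCombination B D).restrictScalars k) :=
    fun y => by simpa using (SetLike.ext_iff.1 h y).symm
  have hT := Module.Flat.lTensor_exact (κ →₀ A) hex
  ext z
  obtain ⟨x, rfl⟩ := (F.freeEquiv κ ι').surjective z
  rw [LinearMap.mem_ker, linearCombination_inducedMatrix, LinearEquiv.map_eq_zero_iff, hT x]
  constructor
  · rintro ⟨w, hw⟩
    obtain ⟨w, rfl⟩ := (F.freeEquiv κ ι'').surjective w
    rw [linearCombination_inducedMatrix] at hw
    exact ⟨w, (F.freeEquiv κ ι').injective hw⟩
  · rintro ⟨w, rfl⟩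
    exact ⟨F.freeEquiv κ ι'' w, F.linearCombination_inducedMatrix κ D' w⟩

/-- The retraction `C → A`, applied to the coordinates. -/
def coordRetraction (κ : Type*) : (κ →₀ C) →ₛₗ[(F.p : C →+* A)] (κ →₀ A) :=
  Finsupp.mapRange.linearMap (F.p : C →+* A).toSemilinearMap

theorem coordRetraction_apply {κ : Type*} (x : κ →₀ C) (s : κ) :
    F.coordRetraction κ x s = F.p (x s) := rfl

/-- The inclusion `A → C`, applied to the coordinates. -/
def coordInclusion (κ : Type*) : (κ →₀ A) →ₗ[k] (κ →₀ C) :=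
  Finsupp.mapRange.linearMap F.f.toLinearMap

theorem coordRetraction_coordInclusion {κ : Type*} (x : κ →₀ A) :
    F.coordRetraction κ (F.coordInclusion κ x) = x := by
  ext s
  exact F.p_f (x s)

theorem coordRetraction_linearCombination {κ κ' : Type*} (D : κ' → κ →₀ A) (y : κ' →₀ C) :
    F.coordRetraction κ (Finsupp.linearCombination C (fun t => F.coordInclusion κ (D t)) y) =
      Finsupp.linearCombination A D (F.coordRetraction κ' y) := by
  induction y using Finsupp.induction_linear with
  | zero => simp
  | add x y hx hy => simp only [map_add, hx, hy]
  | single t c =>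
    have : F.coordRetraction κ' (Finsupp.single t c) = Finsupp.single t (F.p c) := by
      simp [coordRetraction]
    rw [this, Finsupp.linearCombination_single, Finsupp.linearCombination_single]
    simp only [map_smulₛₗ, coordRetraction_coordInclusion]
    rfl

/-- The submodules of free `C`-modules from which the resolution of the trivial module is
assembled by extensions: the inverse images along `C → A` of linearly resolved submodules over `A`,
and the syzygies induced from `B`. -/
inductive IsBuildingBlock : ∀ ι : Type, Submodule C (ι →₀ C) → Prop
  | pullback {κ : Type} {S : Submodule A (κ →₀ A)} : IsLinearlyResolved 𝒜 κ S →
      IsBuildingBlock κ (S.comap (F.coordRetraction κ))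
  | induced (κ : Type) {ι ι' : Type} {D : ι' → ι →₀ B} : (∀ a, D a ∈ coordDegree ℬ ι 1) →
      IsLinearlyResolved ℬ ι' (LinearMap.ker (Finsupp.linearCombination B D)) →
      IsBuildingBlock (κ × ι') (LinearMap.ker (Finsupp.linearCombination C (F.inducedMatrix κ D)))

/-- The kernel of the retraction `C → A` is spanned by `A B_+`. -/
theorem mem_span_of_p_eq_zero (hℬ : IsConnectedGraded ℬ) {c : C} (hc : F.p c = 0) :
    c ∈ Submodule.span k {c | ∃ a, ∃ b ∈ (HomogeneousIdeal.irrelevant ℬ).toIdeal,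
      F.f a * F.g b = c} := by
  suffices h : ∀ c, c - F.f (F.p c) ∈ Submodule.span k
      {c | ∃ a, ∃ b ∈ (HomogeneousIdeal.irrelevant ℬ).toIdeal, F.f a * F.g b = c} by
    simpa [hc] using h c
  intro c
  induction c using F.induction_mul with
  | zero => simp
  | add x y hx hy =>
    convert Submodule.add_mem _ hx hy using 1
    simp only [map_add]
    abel
  | mul a b =>
    obtain ⟨r, hr⟩ := hℬ.exists_algebraMap (SetLike.coe_mem (DirectSum.decompose ℬ b 0))
    have hb : b - algebraMap k B r ∈ (HomogeneousIdeal.irrelevant ℬ).toIdeal := by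
      rw [mem_irrelevant, hr, DirectSum.decompose_sub, DirectSum.sub_apply,
        AddSubgroupClass.coe_sub, DirectSum.decompose_of_mem_same ℬ (SetLike.coe_mem _), sub_self]
    refine Submodule.subset_span ⟨a, _, hb, ?_⟩
    have hp := F.p_g _ hb
    rw [map_sub, map_sub, AlgHom.commutes, AlgHom.commutes, sub_eq_zero] at hp
    rw [map_mul, F.p_f, hp, map_mul, AlgHom.commutes, map_sub, AlgHom.commutes, mul_sub]

variable [GradedAlgebra 𝒞]

/-- A pullback of `S` along `C → A` is covered by the generators of `S`, lifted to `C`, together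
with generators of the kernel `A B_+` of `C → A`, which come from `B`. The syzygies form an extension of
a pullback by an induced syzygy. -/
theorem hasLinearCover_of_isBuildingBlock (hℬ : IsConnectedGraded ℬ)
    (hB : IsLinearlyResolved ℬ Unit (augmentation ℬ)) (ι : Type) (S : Submodule C (ι →₀ C))
    (h : F.IsBuildingBlock ι S) :
    HasLinearCover 𝒞 (ExtensionClosure 𝒞 F.IsBuildingBlock) ι S := by
  cases h with
  | @induced κ ι ι' D hD h =>
    obtain ⟨ι'', D', hD', hr, hk⟩ := h.hasLinearCover
    exact ⟨κ × ι'', F.inducedMatrix κ D', F.inducedMatrix_mem κ hD', F.ker_inducedMatrix κ hr,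
      .base (.induced κ hD' hk)⟩
  | @pullback _ S h =>
    obtain ⟨κ', D, hD, hr, hk⟩ := h.hasLinearCover
    obtain ⟨ι', E, hE, hrE, hkE⟩ := hB.hasLinearCover
    let e : (ι × Unit →₀ C) ≃ₗ[C] (ι →₀ C) := Finsupp.domLCongr (Equiv.prodPUnit ι)
    have he : ∀ x s, e x s = x (s, ()) := fun x s => rfl
    let G : ι × ι' → ι →₀ C := fun i => e (F.inducedMatrix ι E i)
    have hG : Finsupp.linearCombination C G =
        e.toLinearMap ∘ₗ Finsupp.linearCombination C (F.inducedMatrix ι E) := by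
      refine Finsupp.lhom_ext fun i c => ?_
      simp [G]
    have hG₁ : ∀ i, G i ∈ coordDegree 𝒞 ι 1 := fun i s =>
      F.inducedMatrix_mem ι hE i (s, ())
    let H : κ' → ι →₀ C := fun t => F.coordInclusion ι (D t)
    have hH₁ : ∀ t, H t ∈ coordDegree 𝒞 ι 1 := fun t s => F.f_mem _ _ (hD t s)
    -- The matrix `G` covers the kernel of the retraction `C^(ι) → A^(ι)`.
    have hGp : ∀ x, F.coordRetraction ι (Finsupp.linearCombination C G x) = 0 := by
      intro x
      rw [Finsupp.linearCombination_apply, Finsupp.sum, map_sum]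
      refine Finset.sum_eq_zero fun i _ => ?_
      rw [map_smulₛₗ]
      have : F.coordRetraction ι (G i) = 0 := by
        ext s
        rw [coordRetraction_apply, he, inducedMatrix, freeEquiv_apply, map_mul,
          F.p_g _ (mem_irrelevant_of_mem ℬ one_pos (hE _ _)), mul_zero]
        rfl
      rw [this, smul_zero]
    have hGr : ∀ z, F.coordRetraction ι z = 0 → ∃ x, Finsupp.linearCombination C G x = z := by
      intro z hz
      change z ∈ LinearMap.range (Finsupp.linearCombination C G)
      rw [← z.sum_single]
      refine Submodule.sum_mem _ fun s _ => ?_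
      have hs : F.p (z s) = 0 := DFunLike.congr_fun hz s
      have := F.mem_span_of_p_eq_zero hℬ hs
      generalize z s = c at this
      induction this using Submodule.span_induction with
      | zero => simp
      | add x y _ _ hx hy =>
        rw [Finsupp.single_add]
        exact Submodule.add_mem _ hx hy
      | smul r x _ hx =>
        rw [← Finsupp.smul_single, ← algebraMap_smul C r]
        exact Submodule.smul_mem _ _ hx
      | mem c hc =>
        obtain ⟨a, b, hb, rfl⟩ := hc
        have hb' : Finsupp.single () b ∈ LinearMap.range (Finsupp.linearCombination B E) := by
          rw [hrE, mem_augmentation, Finsupp.single_eq_same]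
          exact hb
        obtain ⟨y, hy⟩ := hb'
        refine ⟨F.freeEquiv ι ι' (Finsupp.single s a ⊗ₜ y), ?_⟩
        rw [hG, LinearMap.comp_apply, linearCombination_inducedMatrix, LinearMap.lTensor_tmul,
          LinearMap.restrictScalars_apply, hy, freeEquiv_single]
        exact Finsupp.domLCongr_single _ _ _
    have hS : ∀ y, y ∈ LinearMap.range (Finsupp.linearCombination A D) ↔ y ∈ S := fun y => by
      rw [hr]
    have hmem : ∀ x y, F.coordRetraction ι (Finsupp.linearCombination C G x +
        Finsupp.linearCombination C H y) =
        Finsupp.linearCombination A D (F.coordRetraction κ' y) := by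
      intro x y
      rw [map_add, hGp, zero_add, coordRetraction_linearCombination]
    have hGH : ∀ a, Sum.elim G H a ∈ coordDegree 𝒞 ι 1
      | .inl i => hG₁ i
      | .inr t => hH₁ t
    refine ⟨(ι × ι') ⊕ κ', Sum.elim G H, hGH, le_antisymm ?_ ?_, ?_⟩
    · rintro _ ⟨z, rfl⟩
      obtain ⟨x, y, rfl⟩ := exists_eq_sumElim z
      rw [linearCombination_sumElim, Submodule.mem_comap, hmem, ← hS]
      exact ⟨_, rfl⟩
    · intro z hz
      rw [Submodule.mem_comap, ← hS] at hz
      obtain ⟨w, hw⟩ := hz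
      obtain ⟨x, hx⟩ := hGr (z - Finsupp.linearCombination C H (F.coordInclusion κ' w)) (by
        rw [map_sub, coordRetraction_linearCombination, coordRetraction_coordInclusion, hw,
          sub_self])
      refine ⟨x.sumElim (F.coordInclusion κ' w), ?_⟩
      rw [linearCombination_sumElim, hx, sub_add_cancel]
    · refine .extension (isCoordGraded_ker 𝒞 hGH) (fun x => ?_) (fun y => ?_)
        (.base (.induced ι hE hkE)) (.base (.pullback hk))
      · rw [LinearMap.mem_ker, LinearMap.mem_ker, linearCombination_sumElim, map_zero, add_zero, hG,
          LinearMap.comp_apply]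
        exact (LinearEquiv.map_eq_zero_iff e).symm
      · rw [Submodule.mem_comap, LinearMap.mem_ker]
        constructor
        · intro hy
          obtain ⟨x, hx⟩ := hGr (Finsupp.linearCombination C H y) (by
            rw [coordRetraction_linearCombination, hy])
          refine ⟨-x, ?_⟩
          rw [LinearMap.mem_ker, linearCombination_sumElim, map_neg, hx, neg_add_cancel]
        · rintro ⟨x, hx⟩
          rw [LinearMap.mem_ker, linearCombination_sumElim] at hx
          rw [← hmem x y, hx, map_zero]

/-- If the trivial modules of `A` and `B` have linear resolutions, then so has that of `C`. -/
theorem isLinearlyResolved (F : SplitFactorization 𝒜 ℬ 𝒞) (hℬ : IsConnectedGraded ℬ)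
    (h𝒞 : IsConnectedGraded 𝒞) (hA : IsLinearlyResolved 𝒜 Unit (augmentation 𝒜))
    (hB : IsLinearlyResolved ℬ Unit (augmentation ℬ)) :
    IsLinearlyResolved 𝒞 Unit (augmentation 𝒞) := by
  refine ⟨ExtensionClosure 𝒞 F.IsBuildingBlock, fun ι S hS =>
    hS.hasLinearCover (F.hasLinearCover_of_isBuildingBlock hℬ hB), .base ?_⟩
  -- The ideal `C_+` is the inverse image of `A_+`.
  convert IsBuildingBlock.pullback (F := F) hA using 1
  ext x
  rw [mem_augmentation, Submodule.mem_comap, mem_augmentation, coordRetraction_apply,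
    mem_irrelevant, mem_irrelevant]
  have hd := decompose_map F.p.toLinearMap F.p_mem (x ()) 0
  rw [AlgHom.toLinearMap_apply, AlgHom.toLinearMap_apply] at hd
  rw [hd]
  refine ⟨fun h => by rw [h, map_zero], fun h => ?_⟩
  obtain ⟨c, hc⟩ := h𝒞.exists_algebraMap (SetLike.coe_mem (DirectSum.decompose 𝒞 (x ()) 0))
  have : Nontrivial A := by
    by_contra hA
    rw [not_nontrivial_iff_subsingleton] at hA
    have := h𝒞.nontrivial
    exact one_ne_zero (α := C) (by rw [← map_one F.f, Subsingleton.elim (1 : A) 0, map_zero])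
  rw [← hc] at h ⊢
  rw [AlgHom.commutes, map_eq_zero_iff _ (algebraMap k A).injective] at h
  rw [h, map_zero]

end SplitFactorization

end Factorization

/-! ### Left-right symmetry of the Koszul property -/

theorem exists_finsupp_forall {ι M N : Type*} [Zero M] [Zero N] {P : M → N → Prop}
    (h0 : P 0 0) (u : ι →₀ M) (h : ∀ a, ∃ y, P (u a) y) : ∃ v : ι →₀ N, ∀ a, P (u a) (v a) := by
  classical
  choose y hy using h
  refine ⟨Finsupp.onFinset u.support (fun a => if u a = 0 then 0 else y a) fun a ha => ?_,
    fun a => ?_⟩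
  · rw [Finsupp.mem_support_iff]
    exact fun h => ha (if_pos h)
  · rw [Finsupp.onFinset_apply]
    split_ifs with hu
    · rw [hu]; exact h0
    · exact hy a

theorem exists_basis_fin {k V : Type*} [Field k] [AddCommGroup V] [Module k V] (S : Submodule k V)
    [FiniteDimensional k S] : ∃ (n : ℕ) (b : Fin n → V),
      LinearIndependent k b ∧ Submodule.span k (Set.range b) = S := by
  let b := Module.finBasis k S
  refine ⟨_, S.subtype ∘ b, b.linearIndependent.map' _ S.ker_subtype, ?_⟩
  rw [Set.range_comp, Submodule.span_image, b.span_eq, Submodule.map_top, Submodule.range_subtype]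

section Symmetry

variable {k R R' : Type*} [Field k] [Ring R] [Algebra k R] [Ring R'] [Algebra k R']

/-- An anti-isomorphism of graded algebras. -/
structure GradedAntiEquiv (𝒜 : ℕ → Submodule k R) (𝒜' : ℕ → Submodule k R') where
  /-- The underlying linear isomorphism. -/
  toEquiv : R ≃ₗ[k] R'
  map_mul : ∀ x y, toEquiv (x * y) = toEquiv y * toEquiv x
  mem_iff : ∀ m x, toEquiv x ∈ 𝒜' m ↔ x ∈ 𝒜 m

variable {𝒜 : ℕ → Submodule k R} [GradedAlgebra 𝒜] {𝒜' : ℕ → Submodule k R'}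

namespace GradedAntiEquiv

variable (σ : GradedAntiEquiv 𝒜 𝒜') (L : LinearFreeResolution 𝒜)

/-- The differential of the complex `N ⊗_R P` for a linear free resolution `P` over `R` and a right
`R`-module `N`, which is given as a left module over the opposite algebra `R'`. -/
def tensorD (N : Type*) [AddCommGroup N] [Module R' N] (j : ℕ) :
    (L.ι (j + 1) →₀ N) →+ (L.ι j →₀ N) :=
  Finsupp.liftAddHom fun a =>
    { toFun := fun n => (L.matrix j a).mapRange (fun r => σ.toEquiv r • n) (by simp)
      map_zero' := by ext; simp
      map_add' := fun x y => by ext; simp }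

theorem tensorD_single {N : Type*} [AddCommGroup N] [Module R' N] (j : ℕ) (a : L.ι (j + 1))
    (n : N) (b : L.ι j) :
    σ.tensorD L N j (Finsupp.single a n) b = σ.toEquiv (L.matrix j a b) • n := by
  simp [tensorD]

theorem tensorD_apply {N : Type*} [AddCommGroup N] [Module R' N] (j : ℕ)
    (z : L.ι (j + 1) →₀ N) (b : L.ι j) :
    σ.tensorD L N j z b = z.sum fun a n => σ.toEquiv (L.matrix j a b) • n := by
  simp [tensorD, Finsupp.sum_apply]

theorem tensorD_mapRange {N N' : Type*} [AddCommGroup N] [Module R' N] [AddCommGroup N']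
    [Module R' N'] (φ : N →ₗ[R'] N') (j : ℕ) (z : L.ι (j + 1) →₀ N) :
    σ.tensorD L N' j (Finsupp.mapRange.linearMap φ z) =
      Finsupp.mapRange.linearMap φ (σ.tensorD L N j z) := by
  induction z using Finsupp.induction_linear with
  | zero => simp
  | add x y hx hy => simp only [map_add, hx, hy]
  | single a n =>
    ext b
    rw [Finsupp.mapRange.linearMap_apply, Finsupp.mapRange.linearMap_apply, Finsupp.mapRange_single,
      Finsupp.mapRange_apply, tensorD_single, tensorD_single, map_smul]

theorem tensorD_mem [SetLike.GradedMonoid 𝒜'] {κ : Type*} (j m : ℕ)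
    {z : L.ι (j + 1) →₀ κ →₀ R'} (hz : ∀ a, z a ∈ coordDegree 𝒜' κ m) (b : L.ι j) :
    σ.tensorD L (κ →₀ R') j z b ∈ coordDegree 𝒜' κ (m + 1) := by
  rw [tensorD_apply]
  refine Submodule.sum_mem _ fun a _ s => ?_
  rw [add_comm]
  exact SetLike.mul_mem_graded ((σ.mem_iff _ _).2 (L.matrix_mem j a b)) (hz a s)

/-- The cycles of `N ⊗_R P`; every element of `N ⊗_R P_0` is a cycle. -/
def IsCycle (N : Type*) [AddCommGroup N] [Module R' N] : ∀ j : ℕ, (L.ι j →₀ N) → Prop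
  | 0, _ => True
  | j + 1, z => σ.tensorD L N j z = 0

theorem IsCycle.mapRange {σ : GradedAntiEquiv 𝒜 𝒜'} {L : LinearFreeResolution 𝒜} {N N' : Type*}
    [AddCommGroup N] [Module R' N] [AddCommGroup N'] [Module R' N'] (φ : N →ₗ[R'] N') :
    ∀ {j : ℕ} {z : L.ι j →₀ N}, σ.IsCycle L N j z →
      σ.IsCycle L N' j (Finsupp.mapRange.linearMap φ z)
  | 0, _, _ => trivial
  | j + 1, z, hz => by
    change σ.tensorD L N' j _ = 0
    rw [tensorD_mapRange, show σ.tensorD L N j z = 0 from hz, map_zero]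

theorem tensorD_mapRange_toEquiv (j : ℕ) (x : L.ι (j + 1) →₀ R) :
    σ.tensorD L R' j (Finsupp.mapRange.linearMap σ.toEquiv.toLinearMap x) =
      Finsupp.mapRange.linearMap σ.toEquiv.toLinearMap (L.d j x) := by
  rw [← L.linearCombination_matrix]
  induction x using Finsupp.induction_linear with
  | zero => simp
  | add x y hx hy => simp only [map_add, hx, hy]
  | single a r =>
    ext b
    rw [Finsupp.mapRange.linearMap_apply, Finsupp.mapRange.linearMap_apply, Finsupp.mapRange_single,
      Finsupp.mapRange_apply, tensorD_single, Finsupp.linearCombination_single]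
    exact (σ.map_mul _ _).symm

theorem tensorD_tensorD {N : Type*} [AddCommGroup N] [Module R' N] (j : ℕ)
    (z : L.ι (j + 2) →₀ N) : σ.tensorD L N j (σ.tensorD L N (j + 1) z) = 0 := by
  induction z using Finsupp.induction_linear with
  | zero => simp
  | add x y hx hy => simp only [map_add, hx, hy, add_zero]
  | single a n =>
    have hn : Finsupp.single a n =
        Finsupp.mapRange.linearMap (LinearMap.toSpanSingleton R' N n)
          (Finsupp.mapRange.linearMap σ.toEquiv.toLinearMap
            (Finsupp.single a (σ.toEquiv.symm 1))) := by
      simp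
    rw [hn, tensorD_mapRange, tensorD_mapRange, tensorD_mapRange_toEquiv, tensorD_mapRange_toEquiv,
      (L.exact_succ j).apply_apply_eq_zero, map_zero, map_zero]

variable {L}

/-- In positive degrees, the complex `R ⊗_R P` is exact. -/
theorem exists_tensorD_eq (h : IsConnectedGraded 𝒜) {j m : ℕ} {z : L.ι j →₀ R'}
    (hz : ∀ a, z a ∈ 𝒜' (m + 1)) (hc : σ.IsCycle L R' j z) :
    ∃ w : L.ι (j + 1) →₀ R', (∀ a, w a ∈ 𝒜' m) ∧ σ.tensorD L R' j w = z := by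
  let E : ∀ j, (L.ι j →₀ R) ≃ₗ[k] (L.ι j →₀ R') := fun j => Finsupp.mapRange.linearEquiv σ.toEquiv
  obtain ⟨x, rfl⟩ := (E j).surjective z
  have hx : x ∈ coordDegree 𝒜 (L.ι j) (m + 1) := fun a => (σ.mem_iff _ _).1 (hz a)
  have hr : ∃ y, L.d j y = x := by
    cases j with
    | zero =>
      refine (L.exact_zero x).1 ((L.ε_eq_zero_iff h).2 fun a => ?_)
      exact mem_irrelevant_of_mem 𝒜 m.succ_pos (hx a)
    | succ j =>
      refine (L.exact_succ j x).1 ((E j).injective ?_)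
      rw [map_zero]
      exact (σ.tensorD_mapRange_toEquiv L j x).symm.trans hc
  obtain ⟨y, rfl⟩ := hr
  refine ⟨E (j + 1) (coordProj 𝒜 (L.ι (j + 1)) m y), fun a => ?_, ?_⟩
  · exact (σ.mem_iff _ _).2 (coordProj_mem 𝒜 m y a)
  · refine (σ.tensorD_mapRange_toEquiv L j _).trans (congrArg (E j) ?_)
    rw [← L.linearCombination_matrix, ← coordProj_linearCombination 𝒜 (L.matrix_mem j),
      L.linearCombination_matrix, coordProj_of_mem 𝒜 hx]

/-- In positive degrees, the complex `N ⊗_R P` is exact for a free module `N` of finite rank. -/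
theorem exists_tensorD_eq_of_finite (h : IsConnectedGraded 𝒜) {κ : Type*} [Finite κ] {j m : ℕ}
    {z : L.ι j →₀ κ →₀ R'} (hz : ∀ a, z a ∈ coordDegree 𝒜' κ (m + 1))
    (hc : σ.IsCycle L (κ →₀ R') j z) :
    ∃ w : L.ι (j + 1) →₀ κ →₀ R', (∀ a, w a ∈ coordDegree 𝒜' κ m) ∧
      σ.tensorD L (κ →₀ R') j w = z := by
  classical
  have := Fintype.ofFinite κ
  have hs : ∀ s : κ, ∃ w : L.ι (j + 1) →₀ R', (∀ a, w a ∈ 𝒜' m) ∧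
      σ.tensorD L R' j w = Finsupp.mapRange.linearMap (Finsupp.lapply (R := R') s) z := fun s =>
    σ.exists_tensorD_eq h (fun a => hz a s) (hc.mapRange (Finsupp.lapply (R := R') s))
  choose w hw hwz using hs
  refine ⟨∑ s, Finsupp.mapRange.linearMap (Finsupp.lsingle (R := R') s) (w s), fun a => ?_, ?_⟩
  · rw [Finsupp.finsetSum_apply]
    refine Submodule.sum_mem _ fun s _ t => ?_
    rw [Finsupp.mapRange.linearMap_apply, Finsupp.mapRange_apply, Finsupp.lsingle_apply,
      Finsupp.single_apply]
    split_ifs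
    · exact hw s a
    · exact zero_mem _
  · rw [map_sum]
    simp only [tensorD_mapRange, hwz]
    ext b t
    simp [Finsupp.finsetSum_apply]

variable (L)

/-- For a graded submodule `K` of a free module, the groups `Tor_j(K, k)`, computed from the
resolution `P`, are concentrated in internal degree `j + 1`. -/
def DiagonalTor {κ : Type*} (K : Submodule R' (κ →₀ R')) : Prop :=
  ∀ j m, m ≠ 1 → ∀ z : L.ι j →₀ κ →₀ R', (∀ a, z a ∈ K ∧ z a ∈ coordDegree 𝒜' κ m) →
    σ.IsCycle L (κ →₀ R') j z →
    ∃ w : L.ι (j + 1) →₀ κ →₀ R', (∀ a, w a ∈ K ∧ w a ∈ coordDegree 𝒜' κ (m - 1)) ∧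
      σ.tensorD L (κ →₀ R') j w = z

theorem finiteDimensional_coordDegree (hf : IsLocallyFinite 𝒜') (κ : Type*) [Finite κ] (m : ℕ) :
    FiniteDimensional k (coordDegree 𝒜' κ m) := by
  have := hf m
  let φ : coordDegree 𝒜' κ m →ₗ[k] (κ → 𝒜' m) :=
    { toFun := fun x s => ⟨x.1 s, x.2 s⟩
      map_add' := fun x y => rfl
      map_smul' := fun c x => rfl }
  refine FiniteDimensional.of_injective φ fun x y hxy => ?_
  ext s
  exact congrArg Subtype.val (congrFun hxy s)

variable [GradedAlgebra 𝒜']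

/-- The class of graded submodules of free modules of finite rank which live in positive degrees and
have diagonal `Tor`. -/
def IsTorLinear (κ : Type) (K : Submodule R' (κ →₀ R')) : Prop :=
  Finite κ ∧ IsCoordGraded 𝒜' K ∧ (∀ x ∈ K, x ∈ coordDegree 𝒜' κ 0 → x = 0) ∧ σ.DiagonalTor L K

theorem isTorLinear_augmentation (h : IsConnectedGraded 𝒜) :
    σ.IsTorLinear L Unit (augmentation 𝒜') := by
  have h0 : ∀ x ∈ augmentation 𝒜', x ∈ coordDegree 𝒜' Unit 0 → x = 0 := by
    intro x hx hx0
    ext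
    rw [mem_augmentation, mem_irrelevant, DirectSum.decompose_of_mem_same 𝒜' (hx0 ())] at hx
    exact hx
  refine ⟨inferInstance, fun m x hx => ?_, h0, fun j m hm z hz hc => ?_⟩
  · rw [mem_augmentation, mem_irrelevant] at hx ⊢
    rw [coordProj_apply]
    by_cases hm : m = 0
    · subst hm
      rw [hx, DirectSum.decompose_zero]
      rfl
    · exact DirectSum.decompose_of_mem_ne 𝒜' (SetLike.coe_mem _) hm
  · match m, hm with
    | 0, _ =>
      refine ⟨0, fun a => ⟨zero_mem _, zero_mem _⟩, ?_⟩
      rw [map_zero]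
      ext1 a
      exact (h0 _ (hz a).1 (hz a).2).symm
    | m + 2, _ =>
      obtain ⟨w, hw, rfl⟩ := σ.exists_tensorD_eq_of_finite h (fun a => (hz a).2) hc
      exact ⟨w, fun a => ⟨mem_irrelevant_of_mem 𝒜' m.succ_pos (hw a ()), hw a⟩, rfl⟩

/-- The minimal cover of a module with diagonal `Tor` is linear, and by dimension shifting its
kernel again has diagonal `Tor`. -/
theorem IsTorLinear.hasLinearCover (h : IsConnectedGraded 𝒜) (h' : IsConnectedGraded 𝒜')
    (hf : IsLocallyFinite 𝒜') {κ : Type} {K : Submodule R' (κ →₀ R')}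
    (hK : σ.IsTorLinear L κ K) : HasLinearCover 𝒜' (σ.IsTorLinear L) κ K := by
  obtain ⟨hκ, hgr, h0, htor⟩ := hK
  have := finiteDimensional_coordDegree hf κ 1
  let K₁ : Submodule k (κ →₀ R') := K.restrictScalars k ⊓ coordDegree 𝒜' κ 1
  have : FiniteDimensional k K₁ :=
    Submodule.finiteDimensional_of_le (inf_le_right : K₁ ≤ coordDegree 𝒜' κ 1)
  obtain ⟨n, D, hDli, hDspan⟩ := exists_basis_fin K₁
  have hDK : ∀ t, D t ∈ K₁ := fun t => hDspan ▸ Submodule.subset_span ⟨t, rfl⟩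
  have hD : ∀ t, D t ∈ coordDegree 𝒜' κ 1 := fun t => (hDK t).2
  let φ := Finsupp.linearCombination R' D
  have hφK : ∀ x, φ x ∈ K := by
    intro x
    rw [Finsupp.linearCombination_apply]
    exact Submodule.sum_mem _ fun t _ => K.smul_mem _ (hDK t).1
  obtain ⟨a₀, ha₀⟩ := L.exists_unique_index h
  -- `K` is generated in degree one, because `Tor_0(K, k)` vanishes in the degrees above.
  have hsurj : ∀ m, ∀ x ∈ K, x ∈ coordDegree 𝒜' κ (m + 1) → ∃ y, φ y = x := by
    intro m
    induction m with
    | zero =>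
      intro x hx hx1
      change x ∈ LinearMap.range φ
      have hx' : x ∈ Submodule.span k (Set.range D) := hDspan ▸ ⟨hx, hx1⟩
      refine Submodule.span_le (p := (LinearMap.range φ).restrictScalars k) |>.2 ?_ hx'
      rintro _ ⟨t, rfl⟩
      exact ⟨Finsupp.single t 1, by simp [φ]⟩
    | succ m ih =>
      intro x hx hxm
      obtain ⟨w, hw, hwx⟩ := htor 0 (m + 2) (by omega) (Finsupp.single a₀ x) (fun a => by
        rw [ha₀ a, Finsupp.single_eq_same]
        exact ⟨hx, hxm⟩) trivial
      have hx' := DFunLike.congr_fun hwx a₀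
      rw [Finsupp.single_eq_same, tensorD_apply] at hx'
      change x ∈ LinearMap.range φ
      rw [← hx']
      exact Submodule.sum_mem _ fun a _ => Submodule.smul_mem _ _ (ih _ (hw a).1 (hw a).2)
  have hlift : ∀ m, ∀ x ∈ K, x ∈ coordDegree 𝒜' κ (m + 1) →
      ∃ y ∈ coordDegree 𝒜' (Fin n) m, φ y = x := by
    intro m x hx hxm
    obtain ⟨y, rfl⟩ := hsurj m x hx hxm
    refine ⟨_, coordProj_mem 𝒜' m y, ?_⟩
    rw [← coordProj_linearCombination 𝒜' hD, coordProj_of_mem 𝒜' hxm]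
  -- The generators are linearly independent, so their syzygies live in positive degrees.
  have hker0 : ∀ x ∈ LinearMap.ker φ, x ∈ coordDegree 𝒜' (Fin n) 0 → x = 0 := by
    intro x hx hx0
    choose c hc using fun t => h'.exists_algebraMap (hx0 t)
    have hsum : ∑ t, c t • D t = 0 := by
      rw [LinearMap.mem_ker, Finsupp.linearCombination_apply, Finsupp.sum_fintype _ _ (by simp)]
        at hx
      rw [← hx]
      refine Finset.sum_congr rfl fun t _ => ?_
      rw [← hc, algebraMap_smul]
    have hc0 := Fintype.linearIndependent_iff.1 hDli c hsum
    ext t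
    rw [← hc, hc0, map_zero]
    rfl
  refine ⟨Fin n, D, hD, le_antisymm ?_ fun x hx => ?_, inferInstance, isCoordGraded_ker 𝒜' hD,
    hker0, fun j m hm z hz hc => ?_⟩
  · rintro _ ⟨x, rfl⟩
    exact hφK x
  · change x ∈ LinearMap.range φ
    obtain ⟨s, hs⟩ := exists_sum_coordProj 𝒜' x
    rw [← hs]
    refine Submodule.sum_mem _ fun m _ => ?_
    cases m with
    | zero =>
      rw [h0 _ (hgr 0 x hx) (coordProj_mem 𝒜' 0 x)]
      exact zero_mem _
    | succ m => exact hsurj m _ (hgr _ x hx) (coordProj_mem 𝒜' _ x)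
  · match m, hm with
    | 0, _ =>
      refine ⟨0, fun a => ⟨zero_mem _, zero_mem _⟩, ?_⟩
      rw [map_zero]
      ext1 a
      exact (hker0 _ (hz a).1 (hz a).2).symm
    | m + 2, hm =>
      obtain ⟨w, hw, rfl⟩ := σ.exists_tensorD_eq_of_finite h (fun a => (hz a).2) hc
      -- The cycle `z` bounds a chain `w` of the free module. The image of `w` in `K` is a cycle,
      -- and it bounds since `Tor_{j+1}(K, k)` vanishes in degree `m + 2`; this corrects `w` to a chain
      -- of the kernel.
      have hφw : σ.tensorD L (κ →₀ R') j (Finsupp.mapRange.linearMap φ w) = 0 := by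
        rw [tensorD_mapRange]
        ext1 a
        exact (hz a).1
      obtain ⟨u, hu, huw⟩ := htor (j + 1) (m + 2) hm (Finsupp.mapRange.linearMap φ w)
        (fun a => ⟨hφK _, linearCombination_mem_coordDegree hD (hw a)⟩) hφw
      obtain ⟨v, hv⟩ := exists_finsupp_forall
        (P := fun x y => y ∈ coordDegree 𝒜' (Fin n) m ∧ φ y = x) ⟨zero_mem _, map_zero _⟩ u
        fun a => (hlift m _ (hu a).1 (hu a).2)
      have hvu : Finsupp.mapRange.linearMap φ v = u := by
        ext1 a
        exact (hv a).2
      refine ⟨w - σ.tensorD L _ (j + 1) v, fun a => ⟨?_, ?_⟩, ?_⟩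
      · rw [← hvu, tensorD_mapRange] at huw
        rw [LinearMap.mem_ker, Finsupp.sub_apply, map_sub, sub_eq_zero]
        exact (DFunLike.congr_fun huw a).symm
      · rw [Finsupp.sub_apply]
        exact Submodule.sub_mem _ (hw a) (σ.tensorD_mem L _ _ (fun a => (hv a).1) a)
      · rw [map_sub, tensorD_tensorD, sub_zero]

/-- The Koszul property passes to the opposite algebra. -/
theorem isLinearlyResolved (σ : GradedAntiEquiv 𝒜 𝒜') (h : IsKoszul 𝒜) (h' : IsConnectedGraded 𝒜')
    (hf : IsLocallyFinite 𝒜') : IsLinearlyResolved 𝒜' Unit (augmentation 𝒜') := by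
  obtain ⟨L⟩ := h.exists_resolution
  exact ⟨σ.IsTorLinear L, fun κ K hK => hK.hasLinearCover σ L h.connected h' hf,
    σ.isTorLinear_augmentation L h.connected⟩

end GradedAntiEquiv

end Symmetry

/-! ### Opposite algebras -/

section Opposite

open MulOpposite

variable {k R : Type*} [Field k] [Ring R] [Algebra k R] (𝒜 : ℕ → Submodule k R)

/-- The grading of the opposite algebra. -/
def opGrading (m : ℕ) : Submodule k Rᵐᵒᵖ := (𝒜 m).comap (opLinearEquiv k).symm.toLinearMap

theorem mem_opGrading {m : ℕ} {x : Rᵐᵒᵖ} : x ∈ opGrading 𝒜 m ↔ unop x ∈ 𝒜 m := Iff.rfl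

variable {𝒜} in
theorem IsConnectedGraded.opGrading (h : IsConnectedGraded 𝒜) :
    IsConnectedGraded (opGrading 𝒜) :=
  (((opLinearEquiv k).symm.ofSubmodule' (𝒜 0)).finrank_eq).trans h

variable {𝒜} in
theorem IsLocallyFinite.opGrading (h : IsLocallyFinite 𝒜) : IsLocallyFinite (opGrading 𝒜) :=
  fun m => by
    have := h m
    exact ((opLinearEquiv k).symm.ofSubmodule' (𝒜 m)).symm.finiteDimensional

variable [GradedAlgebra 𝒜]

/-- The opposite algebra is the direct sum of the components of its grading. -/
@[reducible] def opDecomposition : DirectSum.Decomposition (opGrading 𝒜) := by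
  let f : ∀ m, 𝒜 m →ₗ[k] opGrading 𝒜 m := fun m =>
    LinearMap.codRestrict _ ((opLinearEquiv k).toLinearMap ∘ₗ (𝒜 m).subtype) fun x => x.2
  refine DirectSum.Decomposition.ofLinearMap _
    (DirectSum.lmap f ∘ₗ (DirectSum.decomposeLinearEquiv 𝒜).toLinearMap ∘ₗ
      (opLinearEquiv k).symm.toLinearMap) ?_ ?_
  · have h : DirectSum.coeLinearMap (opGrading 𝒜) ∘ₗ DirectSum.lmap f =
        (opLinearEquiv k).toLinearMap ∘ₗ DirectSum.coeLinearMap 𝒜 := by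
      refine DirectSum.linearMap_ext k fun n => LinearMap.ext fun x => ?_
      simp only [LinearMap.comp_apply, DirectSum.lmap_lof, DirectSum.coeLinearMap_lof]
      rfl
    refine LinearMap.ext fun x => ?_
    refine (LinearMap.congr_fun h (DirectSum.decomposeLinearEquiv 𝒜 (unop x))).trans ?_
    exact congrArg op ((DirectSum.decomposeLinearEquiv 𝒜).symm_apply_apply (unop x))
  · refine DirectSum.linearMap_ext k fun n => LinearMap.ext fun x => ?_
    simp only [LinearMap.comp_apply, DirectSum.coeLinearMap_lof, LinearEquiv.coe_coe,
      DirectSum.decomposeLinearEquiv_apply]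
    rw [DirectSum.decompose_of_mem 𝒜 (show (opLinearEquiv k).symm (x : Rᵐᵒᵖ) ∈ 𝒜 n from x.2)]
    exact DirectSum.lmap_lof _ _ _

instance : GradedAlgebra (opGrading 𝒜) where
  toDecomposition := opDecomposition 𝒜
  one_mem := SetLike.one_mem_graded 𝒜
  mul_mem i j x y hx hy := by
    rw [mem_opGrading, unop_mul, add_comm]
    exact SetLike.mul_mem_graded hy hx

theorem decompose_opGrading (x : Rᵐᵒᵖ) (m : ℕ) :
    (DirectSum.decompose (opGrading 𝒜) x m : Rᵐᵒᵖ) = op (DirectSum.decompose 𝒜 (unop x) m : R) :=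
  decompose_map (𝒜 := 𝒜) (𝒜' := opGrading 𝒜) (opLinearEquiv k).toLinearMap (fun _ _ h => h)
    (unop x) m

theorem mem_irrelevant_opGrading {x : Rᵐᵒᵖ} :
    x ∈ (HomogeneousIdeal.irrelevant (opGrading 𝒜)).toIdeal ↔
      unop x ∈ (HomogeneousIdeal.irrelevant 𝒜).toIdeal := by
  rw [mem_irrelevant, mem_irrelevant, decompose_opGrading, op_eq_zero_iff]

variable {𝒜}

/-- The identity, as an anti-isomorphism onto the opposite algebra. -/
def toOp : GradedAntiEquiv 𝒜 (TwistedKoszul.opGrading 𝒜) :=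
  ⟨opLinearEquiv k, fun _ _ => rfl, fun _ _ => Iff.rfl⟩

/-- The identity, as an anti-isomorphism from the opposite algebra. -/
def ofOp : GradedAntiEquiv (TwistedKoszul.opGrading 𝒜) 𝒜 :=
  ⟨(opLinearEquiv k).symm, fun _ _ => rfl, fun _ _ => Iff.rfl⟩

end Opposite

/-! ### Augmentations -/

section Augmentation

variable {k R : Type*} [Field k] [Ring R] [Algebra k R] {𝒜 : ℕ → Submodule k R}
  [GradedAlgebra 𝒜]

theorem IsConnectedGraded.exists_augmentation (h : IsConnectedGraded 𝒜) :
    ∃ ε : R →ₐ[k] k, ∀ r, algebraMap k R (ε r) = DirectSum.decompose 𝒜 r 0 := by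
  have := h.nontrivial
  have hinj : Function.Injective (algebraMap k R) := (algebraMap k R).injective
  choose ε hε using fun r : R => h.exists_algebraMap (SetLike.coe_mem (DirectSum.decompose 𝒜 r 0))
  refine ⟨AlgHom.ofLinearMap
    { toFun := ε
      map_add' := fun x y => hinj ?_
      map_smul' := fun c x => hinj ?_ } (hinj ?_) fun x y => hinj ?_, hε⟩
  · rw [map_add, hε, hε, hε, DirectSum.decompose_add, DirectSum.add_apply, Submodule.coe_add]
  · rw [RingHom.id_apply, smul_eq_mul, map_mul, hε, hε, DirectSum.decompose_smul,
      DirectSum.smul_apply, Submodule.coe_smul, Algebra.smul_def]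
  · change algebraMap k R (ε 1) = _
    rw [hε, DirectSum.decompose_of_mem_same 𝒜 (SetLike.one_mem_graded 𝒜), map_one]
  · change algebraMap k R (ε (x * y)) = algebraMap k R (ε x * ε y)
    rw [map_mul, hε, hε, hε]
    exact map_mul (GradedRing.projZeroRingHom 𝒜) x y

omit [GradedAlgebra 𝒜] in
theorem le_positivePart {i : ℕ} (hi : 0 < i) : 𝒜 i ≤ positivePart 𝒜 :=
  le_iSup₂_of_le (f := fun i (_ : 0 < i) => 𝒜 i) i hi le_rfl

theorem mem_positivePart {r : R} (hr : (DirectSum.decompose 𝒜 r 0 : R) = 0) :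
    r ∈ positivePart 𝒜 := by
  classical
  rw [← DirectSum.sum_support_decompose 𝒜 r]
  refine Submodule.sum_mem _ fun m _ => ?_
  by_cases hm : m = 0
  · subst hm
    rw [hr]
    exact zero_mem _
  · exact le_positivePart (Nat.pos_of_ne_zero hm) (SetLike.coe_mem _)

theorem decompose_zero_of_mem_positivePart {r : R} (hr : r ∈ positivePart 𝒜) :
    (DirectSum.decompose 𝒜 r 0 : R) = 0 := by
  have : positivePart 𝒜 ≤ LinearMap.ker (GradedAlgebra.proj 𝒜 0) :=
    iSup_le fun i => iSup_le fun hi x hx => DirectSum.decompose_of_mem_ne 𝒜 hx hi.ne'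
  exact this hr

theorem IsConnectedGraded.augmentation_eq_zero (h : IsConnectedGraded 𝒜) {ε : R →ₐ[k] k}
    (hε : ∀ r, algebraMap k R (ε r) = DirectSum.decompose 𝒜 r 0) (r : R)
    (hr : r ∈ positivePart 𝒜) : ε r = 0 := by
  have := h.nontrivial
  exact (map_eq_zero_iff _ (algebraMap k R).injective).1
    ((hε r).trans (decompose_zero_of_mem_positivePart hr))

end Augmentation

section Contraction

variable {k A B : Type*} [Field k] [Ring A] [Algebra k A] [Ring B] [Algebra k B]

theorem tmul_mem_tensorSub {S : Submodule k A} {T : Submodule k B} {a : A} {b : B} (ha : a ∈ S)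
    (hb : b ∈ T) : a ⊗ₜ b ∈ tensorSub S T := ⟨⟨a, ha⟩ ⊗ₜ ⟨b, hb⟩, rfl⟩

theorem tensorSub_le {S : Submodule k A} {T : Submodule k B} {P : Submodule k (A ⊗[k] B)}
    (h : ∀ a ∈ S, ∀ b ∈ T, a ⊗ₜ b ∈ P) : tensorSub S T ≤ P := by
  rintro _ ⟨t, rfl⟩
  induction t with
  | zero => simp
  | add x y hx hy => rw [map_add]; exact P.add_mem hx hy
  | tmul a b => exact h a a.2 b b.2

theorem tensorSub_mono {S S' : Submodule k A} {U U' : Submodule k B} (hS : S ≤ S') (hU : U ≤ U') :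
    tensorSub S U ≤ tensorSub S' U' :=
  tensorSub_le fun _ ha _ hb => tmul_mem_tensorSub (hS ha) (hU hb)

variable (B) in
/-- The contraction `η ⊗ 1 : A ⊗ B → B` with an augmentation of `A`. -/
def contractLeft (η : A →ₐ[k] k) : A ⊗[k] B →ₗ[k] B :=
  (TensorProduct.lid k B).toLinearMap ∘ₗ η.toLinearMap.rTensor B

variable (A) in
/-- The contraction `1 ⊗ ε : A ⊗ B → A` with an augmentation of `B`. -/
def contractRight (ε : B →ₐ[k] k) : A ⊗[k] B →ₗ[k] A :=
  (TensorProduct.rid k A).toLinearMap ∘ₗ ε.toLinearMap.lTensor A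

theorem contractLeft_tmul (η : A →ₐ[k] k) (a : A) (b : B) :
    contractLeft B η (a ⊗ₜ b) = η a • b := by
  simp [contractLeft]

theorem contractRight_tmul (ε : B →ₐ[k] k) (a : A) (b : B) :
    contractRight A ε (a ⊗ₜ b) = ε b • a := by
  simp [contractRight]

theorem tensorSub_le_ker_contractLeft {η : A →ₐ[k] k} {S : Submodule k A}
    (hη : ∀ a ∈ S, η a = 0) (T : Submodule k B) :
    tensorSub S T ≤ LinearMap.ker (contractLeft B η) :=
  tensorSub_le fun a ha b _ => by
    rw [LinearMap.mem_ker, contractLeft_tmul, hη a ha, zero_smul]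

theorem tensorSub_le_ker_contractRight {ε : B →ₐ[k] k} {T : Submodule k B}
    (hε : ∀ b ∈ T, ε b = 0) (S : Submodule k A) :
    tensorSub S T ≤ LinearMap.ker (contractRight A ε) :=
  tensorSub_le fun a _ b hb => by
    rw [LinearMap.mem_ker, contractRight_tmul, hε b hb, zero_smul]

end Contraction

/-! ### The twisted tensor product as a factorized algebra -/

section TwistedTensor

variable {k A B : Type*} [Field k] [Ring A] [Algebra k A] [Ring B] [Algebra k B]

namespace TwistedTensorProduct

variable (τ : TwistingMap k A B)

/-- The inclusion `A → A ⊗_τ B`. -/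
def inclLeft : A →ₐ[k] TwistedTensorProduct τ :=
  AlgHom.ofLinearMap
    ((toTensor τ).symm.toLinearMap ∘ₗ (TensorProduct.mk k A B).flip 1) rfl fun x y =>
      (toTensor τ).injective <| by
        rw [toTensor_mul]
        change (x * y) ⊗ₜ 1 = twistedMul τ.toMap ((x ⊗ₜ 1) ⊗ₜ (y ⊗ₜ 1))
        simp [twistedMul_tmul_tmul, τ.map_one_tmul]

/-- The inclusion `B → A ⊗_τ B`. -/
def inclRight : B →ₐ[k] TwistedTensorProduct τ :=
  AlgHom.ofLinearMap
    ((toTensor τ).symm.toLinearMap ∘ₗ TensorProduct.mk k A B 1) rfl fun x y =>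
      (toTensor τ).injective <| by
        rw [toTensor_mul]
        change 1 ⊗ₜ (x * y) = twistedMul τ.toMap ((1 ⊗ₜ x) ⊗ₜ (1 ⊗ₜ y))
        simp [twistedMul_tmul_tmul, τ.map_tmul_one]

theorem toTensor_inclLeft (a : A) : toTensor τ (inclLeft τ a) = a ⊗ₜ 1 := rfl

theorem toTensor_inclRight (b : B) : toTensor τ (inclRight τ b) = 1 ⊗ₜ b := rfl

theorem toTensor_inclLeft_mul_inclRight (a : A) (b : B) :
    toTensor τ (inclLeft τ a * inclRight τ b) = a ⊗ₜ b := by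
  rw [toTensor_mul, toTensor_inclLeft, toTensor_inclRight, twistedMul_tmul_tmul, τ.map_tmul_one]
  simp

theorem toTensor_inclRight_mul_inclLeft (a : A) (b : B) :
    toTensor τ (inclRight τ b * inclLeft τ a) = τ.toMap (b ⊗ₜ a) := by
  rw [toTensor_mul, toTensor_inclLeft, toTensor_inclRight, twistedMul_tmul_tmul]
  simp

theorem mul_inclusions : LinearMap.mul' k (TwistedTensorProduct τ) ∘ₗ
    TensorProduct.map (inclLeft τ).toLinearMap (inclRight τ).toLinearMap =
      (toTensor τ).symm.toLinearMap := by
  refine TensorProduct.ext' fun a b => (toTensor τ).injective ?_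
  exact (toTensor_inclLeft_mul_inclRight τ a b).trans ((toTensor τ).apply_symm_apply _).symm

theorem bijective_mul_inclusions : Function.Bijective (LinearMap.mul' k (TwistedTensorProduct τ) ∘ₗ
    TensorProduct.map (inclLeft τ).toLinearMap (inclRight τ).toLinearMap) := by
  rw [mul_inclusions]
  exact (toTensor τ).symm.bijective

end TwistedTensorProduct

namespace GradedTwistingMap

open TwistedTensorProduct

variable {𝒜 : ℕ → Submodule k A} {ℬ : ℕ → Submodule k B}

theorem finrank_kunneth_zero (h𝒜 : IsConnectedGraded 𝒜) (hℬ : IsConnectedGraded ℬ) :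
    Module.finrank k (kunneth 𝒜 ℬ 0) = 1 := by
  have : kunneth 𝒜 ℬ 0 = tensorSub (𝒜 0) (ℬ 0) := by
    refine le_antisymm (kunneth_le fun p q hpq v hv w hw => ?_)
      (le_iSup_of_le 0 (le_iSup_of_le 0 (le_iSup_of_le rfl le_rfl)))
    obtain ⟨rfl, rfl⟩ : p = 0 ∧ q = 0 := by omega
    exact tmul_mem_tensorSub hv hw
  rw [this, tensorSub, LinearMap.finrank_range_of_inj
    (Module.Flat.tensorProduct_mapIncl_injective_of_right _ _), Module.finrank_tensorProduct,
    h𝒜, hℬ]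

theorem finiteDimensional_kunneth (h𝒜 : IsLocallyFinite 𝒜) (hℬ : IsLocallyFinite ℬ) (n : ℕ) :
    FiniteDimensional k (kunneth 𝒜 ℬ n) := by
  have : ∀ i : ℕ × ℕ, FiniteDimensional k (tensorSub (𝒜 i.1) (ℬ i.2)) := fun i => by
    have := h𝒜 i.1
    have := hℬ i.2
    rw [tensorSub]
    infer_instance
  refine Submodule.finiteDimensional_of_le
    (S₂ := (Finset.HasAntidiagonal.antidiagonal n).sup
      fun i : ℕ × ℕ => tensorSub (𝒜 i.1) (ℬ i.2)) ?_
  refine kunneth_le fun p q hpq v hv w hw => ?_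
  exact Finset.le_sup (f := fun i : ℕ × ℕ => tensorSub (𝒜 i.1) (ℬ i.2))
    (b := (p, q)) (Finset.HasAntidiagonal.mem_antidiagonal.2 hpq) (tmul_mem_tensorSub hv hw)

variable (τ : GradedTwistingMap 𝒜 ℬ)

theorem isConnectedGraded_grading (h𝒜 : IsConnectedGraded 𝒜) (hℬ : IsConnectedGraded ℬ) :
    IsConnectedGraded τ.grading :=
  finrank_kunneth_zero h𝒜 hℬ

theorem isLocallyFinite_grading (h𝒜 : IsLocallyFinite 𝒜) (hℬ : IsLocallyFinite ℬ) :
    IsLocallyFinite τ.grading :=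
  finiteDimensional_kunneth h𝒜 hℬ

theorem inclLeft_mem [SetLike.GradedMonoid ℬ] (m : ℕ) (a : A) (ha : a ∈ 𝒜 m) :
    inclLeft τ.toTwistingMap a ∈ τ.grading m :=
  tmul_mem_kunneth (q := 0) ha (SetLike.one_mem_graded ℬ)

theorem inclRight_mem [SetLike.GradedMonoid 𝒜] (m : ℕ) (b : B) (hb : b ∈ ℬ m) :
    inclRight τ.toTwistingMap b ∈ τ.grading m := by
  have := tmul_mem_kunneth (p := 0) (SetLike.one_mem_graded 𝒜) hb
  rwa [zero_add] at this

variable [GradedAlgebra 𝒜] [GradedAlgebra ℬ]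

/-- A linear map that vanishes on `τ(B_+ ⊗ A_+)` is determined on the image of `τ` by its values on
`A ⊗ 1` and `1 ⊗ B`. -/
theorem map_toMap_eq {V : Type*} [AddCommGroup V] [Module k V] (q : A ⊗[k] B →ₗ[k] V)
    (hq : ∀ x ∈ tensorSub (positivePart ℬ) (positivePart 𝒜), q (τ.toMap x) = 0)
    {η : A →ₐ[k] k} (hη : ∀ a, algebraMap k A (η a) = DirectSum.decompose 𝒜 a 0)
    {ε : B →ₐ[k] k} (hε : ∀ b, algebraMap k B (ε b) = DirectSum.decompose ℬ b 0) (a : A) (b : B) :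
    q (τ.toMap (b ⊗ₜ a)) =
      ε b • q (a ⊗ₜ 1) + η a • q (1 ⊗ₜ b) - (ε b * η a) • q (1 ⊗ₜ 1) := by
  have hb : b - ε b • 1 ∈ positivePart ℬ := mem_positivePart (by
    rw [← Algebra.algebraMap_eq_smul_one, hε, DirectSum.decompose_sub, DirectSum.sub_apply,
      AddSubgroupClass.coe_sub, DirectSum.decompose_of_mem_same ℬ (SetLike.coe_mem _), sub_self])
  have ha : a - η a • 1 ∈ positivePart 𝒜 := mem_positivePart (by
    rw [← Algebra.algebraMap_eq_smul_one, hη, DirectSum.decompose_sub, DirectSum.sub_apply,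
      AddSubgroupClass.coe_sub, DirectSum.decompose_of_mem_same 𝒜 (SetLike.coe_mem _), sub_self])
  have h0 : q (τ.toMap ((b - ε b • 1) ⊗ₜ (a - η a • 1))) = 0 :=
    hq _ (tmul_mem_tensorSub hb ha)
  have hba : b ⊗ₜ[k] a = (b - ε b • 1) ⊗ₜ (a - η a • 1) + ε b • (1 ⊗ₜ a) + η a • (b ⊗ₜ 1) -
      (ε b * η a) • (1 ⊗ₜ 1) := by
    simp only [TensorProduct.sub_tmul, TensorProduct.tmul_sub, ← TensorProduct.smul_tmul',
      TensorProduct.tmul_smul]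
    module
  rw [hba]
  simp only [map_sub, map_add, map_smul, h0, τ.map_one_tmul, τ.map_tmul_one, zero_add]

/-- If `τ(B_+ ⊗ A_+) ⊆ A ⊗ B_+`, then `A ⊗ B_+` is an ideal, with quotient `A`. -/
theorem exists_splitFactorization_of_right (h𝒜 : IsConnectedGraded 𝒜) (hℬ : IsConnectedGraded ℬ)
    (hτ : ∀ x ∈ tensorSub (positivePart ℬ) (positivePart 𝒜), τ.toMap x ∈
      tensorSub (positivePart 𝒜) (positivePart ℬ) ⊔ tensorSub (𝒜 0) (positivePart ℬ)) :
    Nonempty (SplitFactorization 𝒜 ℬ τ.grading) := by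
  obtain ⟨η, hη⟩ := h𝒜.exists_augmentation
  obtain ⟨ε, hε⟩ := hℬ.exists_augmentation
  have hε0 : ∀ b ∈ positivePart ℬ, ε b = 0 := hℬ.augmentation_eq_zero hε
  let q : A ⊗[k] B →ₗ[k] A := contractRight A ε
  have hq : ∀ a b, q (a ⊗ₜ b) = ε b • a := contractRight_tmul ε
  have hq0 : ∀ S : Submodule k A, tensorSub S (positivePart ℬ) ≤ LinearMap.ker q :=
    tensorSub_le_ker_contractRight hε0
  have hqτ : ∀ b a, q (τ.toMap (b ⊗ₜ a)) = ε b • a := by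
    intro b a
    rw [τ.map_toMap_eq q (fun x hx => (sup_le (hq0 _) (hq0 _) :
        tensorSub (positivePart 𝒜) (positivePart ℬ) ⊔ tensorSub (𝒜 0) (positivePart ℬ) ≤
          LinearMap.ker q) (hτ x hx)) hη hε, hq, hq, hq]
    simp only [map_one, one_smul]
    module
  have hqm : ∀ x y, q (twistedMul τ.toMap (x ⊗ₜ y)) = q x * q y := by
    intro x y
    induction x with
    | zero => simp
    | add x x' hx hx' => simp only [TensorProduct.add_tmul, map_add, hx, hx', add_mul]
    | tmul a b =>
      induction y with
      | zero => simp
      | add y y' hy hy' => simp only [TensorProduct.tmul_add, map_add, hy, hy', mul_add]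
      | tmul a' b' =>
        have hu : ∀ u, q (TensorProduct.map (LinearMap.mulLeft k a) (LinearMap.mulRight k b') u) =
            ε b' • (a * q u) := by
          intro u
          induction u with
          | zero => simp
          | add u v hu hv => simp only [map_add, hu, hv, mul_add, smul_add]
          | tmul x y =>
            simp only [TensorProduct.map_tmul, LinearMap.mulLeft_apply, LinearMap.mulRight_apply,
              hq, map_mul, mul_smul_comm, smul_smul, mul_comm]
        rw [twistedMul_tmul_tmul, hu, hqτ, hq, hq]
        simp only [mul_smul_comm, smul_mul_assoc, smul_smul]
  exact ⟨
    { f := inclLeft _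
      g := inclRight _
      p := AlgHom.ofLinearMap (q ∘ₗ (toTensor τ.toTwistingMap).toLinearMap)
        ((hq 1 1).trans (by rw [map_one, one_smul]))
        fun x y => by
          simp only [LinearMap.comp_apply, LinearEquiv.coe_coe, toTensor_mul, hqm]
      f_mem := τ.inclLeft_mem
      g_mem := τ.inclRight_mem
      p_mem := fun m c hc => by
        refine (kunneth_le (P := (𝒜 m).comap q) fun i j hij a ha b hb => ?_) hc
        rw [Submodule.mem_comap, hq]
        by_cases hj : j = 0
        · rw [← hij, hj, add_zero]
          exact Submodule.smul_mem _ _ ha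
        · rw [hε0 b (le_positivePart (Nat.pos_of_ne_zero hj) hb), zero_smul]
          exact zero_mem _
      bijective := bijective_mul_inclusions _
      p_f := fun a => (hq a 1).trans (by rw [map_one, one_smul])
      p_g := fun b hb => (hq 1 b).trans (by
        rw [hε0 b (mem_positivePart ((mem_irrelevant ℬ).1 hb)), zero_smul]) }⟩

/-- If `τ(B_+ ⊗ A_+) ⊆ A_+ ⊗ B`, then `A_+ ⊗ B` is an ideal, with quotient `B`, and the opposite
algebras are in the situation of `SplitFactorization`. -/
theorem exists_splitFactorization_of_left (h𝒜 : IsConnectedGraded 𝒜) (hℬ : IsConnectedGraded ℬ)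
    (hτ : ∀ x ∈ tensorSub (positivePart ℬ) (positivePart 𝒜), τ.toMap x ∈
      tensorSub (positivePart 𝒜) (ℬ 0) ⊔ tensorSub (positivePart 𝒜) (positivePart ℬ)) :
    Nonempty (SplitFactorization (opGrading ℬ) (opGrading 𝒜) (opGrading τ.grading)) := by
  obtain ⟨η, hη⟩ := h𝒜.exists_augmentation
  obtain ⟨ε, hε⟩ := hℬ.exists_augmentation
  have hη0 : ∀ a ∈ positivePart 𝒜, η a = 0 := h𝒜.augmentation_eq_zero hη
  let q : A ⊗[k] B →ₗ[k] B := contractLeft B η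
  have hq : ∀ a b, q (a ⊗ₜ b) = η a • b := contractLeft_tmul η
  have hq0 : ∀ S : Submodule k B, tensorSub (positivePart 𝒜) S ≤ LinearMap.ker q :=
    tensorSub_le_ker_contractLeft hη0
  have hqτ : ∀ b a, q (τ.toMap (b ⊗ₜ a)) = η a • b := by
    intro b a
    rw [τ.map_toMap_eq q (fun x hx => (sup_le (hq0 _) (hq0 _) :
        tensorSub (positivePart 𝒜) (ℬ 0) ⊔ tensorSub (positivePart 𝒜) (positivePart ℬ) ≤
          LinearMap.ker q) (hτ x hx)) hη hε, hq, hq, hq]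
    simp only [map_one, one_smul]
    module
  have hqm : ∀ x y, q (twistedMul τ.toMap (x ⊗ₜ y)) = q x * q y := by
    intro x y
    induction x with
    | zero => simp
    | add x x' hx hx' => simp only [TensorProduct.add_tmul, map_add, hx, hx', add_mul]
    | tmul a b =>
      induction y with
      | zero => simp
      | add y y' hy hy' => simp only [TensorProduct.tmul_add, map_add, hy, hy', mul_add]
      | tmul a' b' =>
        have hu : ∀ u, q (TensorProduct.map (LinearMap.mulLeft k a) (LinearMap.mulRight k b') u) =
            η a • (q u * b') := by
          intro u
          induction u with
          | zero => simp
          | add u v hu hv => simp only [map_add, hu, hv, add_mul, smul_add]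
          | tmul x y =>
            simp only [TensorProduct.map_tmul, LinearMap.mulLeft_apply, LinearMap.mulRight_apply,
              hq, map_mul, smul_mul_assoc, smul_smul]
        rw [twistedMul_tmul_tmul, hu, hqτ, hq, hq]
        simp only [mul_smul_comm, smul_mul_assoc, smul_smul, mul_comm]
  let Q : TwistedTensorProduct τ.toTwistingMap →ₐ[k] B :=
    AlgHom.ofLinearMap (q ∘ₗ (toTensor τ.toTwistingMap).toLinearMap)
      ((hq 1 1).trans (by rw [map_one, one_smul]))
      fun x y => by simp only [LinearMap.comp_apply, LinearEquiv.coe_coe, toTensor_mul, hqm]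
  exact ⟨
    { f := AlgHom.op (inclRight _)
      g := AlgHom.op (inclLeft _)
      p := AlgHom.op Q
      f_mem := fun m b hb => τ.inclRight_mem m _ hb
      g_mem := fun m a ha => τ.inclLeft_mem m _ ha
      p_mem := fun m c hc => by
        refine (kunneth_le (P := (ℬ m).comap q) fun i j hij a ha b hb => ?_) hc
        rw [Submodule.mem_comap, hq]
        by_cases hi : i = 0
        · rw [← hij, hi, zero_add]
          exact Submodule.smul_mem _ _ hb
        · rw [hη0 a (le_positivePart (Nat.pos_of_ne_zero hi) ha), zero_smul]
          exact zero_mem _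
      bijective := by
        let e : Bᵐᵒᵖ ⊗[k] Aᵐᵒᵖ ≃ₗ[k] (TwistedTensorProduct τ.toTwistingMap)ᵐᵒᵖ :=
          TensorProduct.congr (MulOpposite.opLinearEquiv k).symm
            (MulOpposite.opLinearEquiv k).symm ≪≫ₗ
            TensorProduct.comm k B A ≪≫ₗ (toTensor τ.toTwistingMap).symm ≪≫ₗ
              MulOpposite.opLinearEquiv k
        have he : LinearMap.mul' k (TwistedTensorProduct τ.toTwistingMap)ᵐᵒᵖ ∘ₗ
            TensorProduct.map (AlgHom.op (inclRight τ.toTwistingMap)).toLinearMap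
              (AlgHom.op (inclLeft τ.toTwistingMap)).toLinearMap = e.toLinearMap := by
          refine TensorProduct.ext' fun b a => MulOpposite.unop_injective ?_
          refine (toTensor τ.toTwistingMap).injective ?_
          exact toTensor_inclLeft_mul_inclRight _ a.unop b.unop
        rw [he]
        exact e.bijective
      p_f := fun b => MulOpposite.unop_injective
        ((hq 1 b.unop).trans (by rw [map_one, one_smul]))
      p_g := fun a ha => MulOpposite.unop_injective ((hq a.unop 1).trans (by
        rw [hη0 _ (mem_positivePart ((mem_irrelevant 𝒜).1 ((mem_irrelevant_opGrading 𝒜).1 ha))),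
          zero_smul]
        rfl)) }⟩

theorem isKoszul_grading (hτ : τ.IsOneSided) (hA : IsKoszul 𝒜) (hB : IsKoszul ℬ) :
    IsKoszul τ.grading := by
  have hc := τ.isConnectedGraded_grading hA.connected hB.connected
  have hf := τ.isLocallyFinite_grading hA.locallyFinite hB.locallyFinite
  refine ⟨hc, hf, IsLinearlyResolved.nonempty_linearFreeResolution ?_⟩
  rcases hτ with hτ | hτ
  · obtain ⟨F⟩ := τ.exists_splitFactorization_of_left hA.connected hB.connected hτ
    have hop := F.isLinearlyResolved hA.connected.opGrading hc.opGrading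
      (toOp.isLinearlyResolved hB hB.connected.opGrading hB.locallyFinite.opGrading)
      (toOp.isLinearlyResolved hA hA.connected.opGrading hA.locallyFinite.opGrading)
    exact ofOp.isLinearlyResolved
      ⟨hc.opGrading, hf.opGrading, hop.nonempty_linearFreeResolution⟩ hc hf
  · obtain ⟨F⟩ := τ.exists_splitFactorization_of_right hA.connected hB.connected hτ
    exact F.isLinearlyResolved hB.connected hc hA.isLinearlyResolved hB.isLinearlyResolved

end GradedTwistingMap

end TwistedTensor

/-! ### Straightening words modulo an ideal -/

section Straightening

variable {k T : Type*} [Field k] [Ring T] [Algebra k T] {V W J : Submodule k T}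

theorem pow_mul_le_of_mul_le_left (hl : ∀ X : Submodule k T, X * J ≤ J)
    (hr : ∀ X : Submodule k T, J * X ≤ J) (h : W * V ≤ V * (V ⊔ W) ⊔ J) (n : ℕ) :
    W ^ n * V ≤ V * (V ⊔ W) ^ n ⊔ J := by
  induction n with
  | zero => simp
  | succ n ih =>
    calc W ^ (n + 1) * V = W ^ n * (W * V) := by rw [pow_succ, mul_assoc]
      _ ≤ W ^ n * (V * (V ⊔ W) ⊔ J) := mul_le_mul' le_rfl h
      _ = W ^ n * V * (V ⊔ W) ⊔ W ^ n * J := by rw [Submodule.mul_sup, mul_assoc]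
      _ ≤ (V * (V ⊔ W) ^ n ⊔ J) * (V ⊔ W) ⊔ J := sup_le_sup (mul_le_mul' ih le_rfl) (hl _)
      _ = V * (V ⊔ W) ^ (n + 1) ⊔ J * (V ⊔ W) ⊔ J := by
        rw [Submodule.sup_mul, pow_succ, mul_assoc]
      _ ≤ V * (V ⊔ W) ^ (n + 1) ⊔ J :=
        sup_le (sup_le le_sup_left ((hr _).trans le_sup_right)) le_sup_right

/-- If a product of a letter in `W` with a letter in `V` can be rewritten, modulo an ideal, so that
it begins with a letter in `V`, then so can every word that is not a word in `W`. -/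
theorem sup_pow_succ_le_of_mul_le_left (hl : ∀ X : Submodule k T, X * J ≤ J)
    (hr : ∀ X : Submodule k T, J * X ≤ J) (h : W * V ≤ V * (V ⊔ W) ⊔ J) (n : ℕ) :
    (V ⊔ W) ^ (n + 1) ≤ V * (V ⊔ W) ^ n ⊔ W ^ (n + 1) ⊔ J := by
  induction n with
  | zero => simp
  | succ n ih =>
    calc (V ⊔ W) ^ (n + 2) = (V ⊔ W) ^ (n + 1) * (V ⊔ W) := pow_succ _ _
      _ ≤ (V * (V ⊔ W) ^ n ⊔ W ^ (n + 1) ⊔ J) * (V ⊔ W) := mul_le_mul' ih le_rfl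
      _ = V * (V ⊔ W) ^ (n + 1) ⊔ (W ^ (n + 1) * V ⊔ W ^ (n + 2)) ⊔ J * (V ⊔ W) := by
        rw [Submodule.sup_mul, Submodule.sup_mul, mul_assoc, ← pow_succ, Submodule.mul_sup,
          ← pow_succ]
      _ ≤ V * (V ⊔ W) ^ (n + 1) ⊔ W ^ (n + 2) ⊔ J :=
        sup_le (sup_le (le_sup_left.trans le_sup_left)
          (sup_le ((pow_mul_le_of_mul_le_left hl hr h _).trans
            (sup_le_sup_right le_sup_left _)) (le_sup_right.trans le_sup_left)))
          ((hr _).trans le_sup_right)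

theorem mul_pow_le_of_mul_le_right (hl : ∀ X : Submodule k T, X * J ≤ J)
    (hr : ∀ X : Submodule k T, J * X ≤ J) (h : W * V ≤ (V ⊔ W) * W ⊔ J) (n : ℕ) :
    W * V ^ n ≤ (V ⊔ W) ^ n * W ⊔ J := by
  induction n with
  | zero => simp
  | succ n ih =>
    calc W * V ^ (n + 1) = W * V * V ^ n := by rw [pow_succ', mul_assoc]
      _ ≤ ((V ⊔ W) * W ⊔ J) * V ^ n := mul_le_mul' h le_rfl
      _ = (V ⊔ W) * (W * V ^ n) ⊔ J * V ^ n := by rw [Submodule.sup_mul, mul_assoc]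
      _ ≤ (V ⊔ W) * ((V ⊔ W) ^ n * W ⊔ J) ⊔ J := sup_le_sup (mul_le_mul' le_rfl ih) (hr _)
      _ = (V ⊔ W) ^ (n + 1) * W ⊔ (V ⊔ W) * J ⊔ J := by
        rw [Submodule.mul_sup, pow_succ', mul_assoc]
      _ ≤ (V ⊔ W) ^ (n + 1) * W ⊔ J :=
        sup_le (sup_le le_sup_left ((hl _).trans le_sup_right)) le_sup_right

/-- The mirror image of `sup_pow_succ_le_of_mul_le_left`. -/
theorem sup_pow_succ_le_of_mul_le_right (hl : ∀ X : Submodule k T, X * J ≤ J)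
    (hr : ∀ X : Submodule k T, J * X ≤ J) (h : W * V ≤ (V ⊔ W) * W ⊔ J) (n : ℕ) :
    (V ⊔ W) ^ (n + 1) ≤ (V ⊔ W) ^ n * W ⊔ V ^ (n + 1) ⊔ J := by
  induction n with
  | zero => simp [sup_comm]
  | succ n ih =>
    calc (V ⊔ W) ^ (n + 2) = (V ⊔ W) * (V ⊔ W) ^ (n + 1) := pow_succ' _ _
      _ ≤ (V ⊔ W) * ((V ⊔ W) ^ n * W ⊔ V ^ (n + 1) ⊔ J) := mul_le_mul' le_rfl ih
      _ = (V ⊔ W) ^ (n + 1) * W ⊔ (V ^ (n + 2) ⊔ W * V ^ (n + 1)) ⊔ (V ⊔ W) * J := by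
        rw [Submodule.mul_sup, Submodule.mul_sup, ← mul_assoc, ← pow_succ',
          Submodule.sup_mul _ _ (V ^ (n + 1)), ← pow_succ']
      _ ≤ (V ⊔ W) ^ (n + 1) * W ⊔ V ^ (n + 2) ⊔ J :=
        sup_le (sup_le (le_sup_left.trans le_sup_left)
          (sup_le (le_sup_right.trans le_sup_left) ((mul_pow_le_of_mul_le_right hl hr h _).trans
            (sup_le_sup_right le_sup_left _))))
          ((hl _).trans le_sup_right)

/-- The two ways to straighten products of letters in `W` with letters in `V`, modulo an ideal:
the result begins with a letter in `V`, or it ends with a letter in `W`. In both cases every word is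
congruent to a combination of products of a word in `V` with a word in `W`. -/
theorem sup_pow_le_mul (hl : ∀ X : Submodule k T, X * J ≤ J) (hr : ∀ X : Submodule k T, J * X ≤ J)
    (h : W * V ≤ V * (V ⊔ W) ⊔ J ∨ W * V ≤ (V ⊔ W) * W ⊔ J) {S S' : Subalgebra k T}
    (hV : V ≤ S.toSubmodule) (hW : W ≤ S'.toSubmodule) (n : ℕ) :
    (V ⊔ W) ^ n ≤ S.toSubmodule * S'.toSubmodule ⊔ J := by
  have h1 : (1 : Submodule k T) ≤ S.toSubmodule := Submodule.one_le.2 S.one_mem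
  have h1' : (1 : Submodule k T) ≤ S'.toSubmodule := Submodule.one_le.2 S'.one_mem
  have hVn : ∀ n, V ^ n ≤ S.toSubmodule := by
    intro n
    induction n with
    | zero => exact h1
    | succ n ih =>
      rw [pow_succ, ← (Subalgebra.isIdempotentElem_toSubmodule S).eq]
      exact mul_le_mul' ih hV
  have hWn : ∀ n, W ^ n ≤ S'.toSubmodule := by
    intro n
    induction n with
    | zero => exact h1'
    | succ n ih =>
      rw [pow_succ, ← (Subalgebra.isIdempotentElem_toSubmodule S').eq]
      exact mul_le_mul' ih hW
  have hS : S.toSubmodule ≤ S.toSubmodule * S'.toSubmodule := by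
    simpa using mul_le_mul' (le_refl S.toSubmodule) h1'
  have hS' : S'.toSubmodule ≤ S.toSubmodule * S'.toSubmodule := by
    simpa using mul_le_mul' h1 (le_refl S'.toSubmodule)
  induction n with
  | zero => exact (h1.trans hS).trans le_sup_left
  | succ n ih =>
    rcases h with h | h
    · refine (sup_pow_succ_le_of_mul_le_left hl hr h n).trans (sup_le (sup_le ?_
        (((hWn _).trans hS').trans le_sup_left)) le_sup_right)
      refine (mul_le_mul' hV ih).trans ?_
      rw [Submodule.mul_sup, ← mul_assoc, (Subalgebra.isIdempotentElem_toSubmodule S).eq]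
      exact sup_le_sup_left (hl _) _
    · refine (sup_pow_succ_le_of_mul_le_right hl hr h n).trans (sup_le (sup_le ?_
        (((hVn _).trans hS).trans le_sup_left)) le_sup_right)
      refine (mul_le_mul' ih hW).trans ?_
      rw [Submodule.sup_mul, mul_assoc, (Subalgebra.isIdempotentElem_toSubmodule S').eq]
      exact sup_le_sup_left (hr _) _

end Straightening

/-! ### Quadratic twisted tensor products -/

section DegreeTwo

variable {k A B : Type*} [Field k] [Ring A] [Algebra k A] [Ring B] [Algebra k B]
  {𝒜 : ℕ → Submodule k A} [GradedAlgebra 𝒜] {ℬ : ℕ → Submodule k B} [GradedAlgebra ℬ]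

omit [GradedAlgebra ℬ] in
/-- The component of an element of `A ⊗ B` of degree two in `A_0 ⊗ B_2` is detected by the
augmentation of `A`. -/
theorem mem_of_mem_kunneth_two_left (hA : IsConnectedGraded 𝒜) {Y : Submodule k (A ⊗[k] B)}
    (h11 : ∀ a ∈ 𝒜 1, ∀ b ∈ ℬ 1, a ⊗ₜ b ∈ Y) (h20 : ∀ a ∈ 𝒜 2, ∀ b ∈ ℬ 0, a ⊗ₜ b ∈ Y)
    {x : A ⊗[k] B} (hx : x ∈ kunneth 𝒜 ℬ 2) (hx' : x ∈ tensorSub (positivePart 𝒜) ⊤) : x ∈ Y := by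
  obtain ⟨η, hη⟩ := hA.exists_augmentation
  have hη0 : ∀ a ∈ positivePart 𝒜, η a = 0 := hA.augmentation_eq_zero hη
  have hdec : kunneth 𝒜 ℬ 2 ≤ LinearMap.range (TensorProduct.mk k A B 1) ⊔
      (LinearMap.ker (contractLeft B η) ⊓ Y) := by
    refine kunneth_le fun i j hij v hv w hw => ?_
    obtain ⟨rfl, rfl⟩ | ⟨rfl, rfl⟩ | ⟨rfl, rfl⟩ :
      i = 0 ∧ j = 2 ∨ i = 1 ∧ j = 1 ∨ i = 2 ∧ j = 0 := by omega
    · obtain ⟨r, rfl⟩ := hA.exists_algebraMap hv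
      refine Submodule.mem_sup_left ⟨r • w, ?_⟩
      rw [Algebra.algebraMap_eq_smul_one, TensorProduct.smul_tmul, TensorProduct.mk_apply]
    · refine Submodule.mem_sup_right (Submodule.mem_inf.2 ⟨?_, h11 v hv w hw⟩)
      rw [LinearMap.mem_ker, contractLeft_tmul, hη0 _ (le_positivePart Nat.one_pos hv), zero_smul]
    · refine Submodule.mem_sup_right (Submodule.mem_inf.2 ⟨?_, h20 v hv w hw⟩)
      rw [LinearMap.mem_ker, contractLeft_tmul, hη0 _ (le_positivePart Nat.two_pos hv), zero_smul]
  obtain ⟨_, ⟨w, rfl⟩, z, hz, rfl⟩ := Submodule.mem_sup.1 (hdec hx)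
  obtain ⟨hz, hzY⟩ := Submodule.mem_inf.1 hz
  have hw := LinearMap.mem_ker.1 (tensorSub_le_ker_contractLeft hη0 _ hx')
  rw [map_add, LinearMap.mem_ker.1 hz, add_zero, TensorProduct.mk_apply, contractLeft_tmul, map_one,
    one_smul] at hw
  rw [hw, map_zero, zero_add]
  exact hzY

omit [GradedAlgebra 𝒜] in
/-- The component of an element of `A ⊗ B` of degree two in `A_2 ⊗ B_0` is detected by the
augmentation of `B`. -/
theorem mem_of_mem_kunneth_two_right (hB : IsConnectedGraded ℬ) {Y : Submodule k (A ⊗[k] B)}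
    (h11 : ∀ a ∈ 𝒜 1, ∀ b ∈ ℬ 1, a ⊗ₜ b ∈ Y) (h02 : ∀ a ∈ 𝒜 0, ∀ b ∈ ℬ 2, a ⊗ₜ b ∈ Y)
    {x : A ⊗[k] B} (hx : x ∈ kunneth 𝒜 ℬ 2) (hx' : x ∈ tensorSub ⊤ (positivePart ℬ)) : x ∈ Y := by
  obtain ⟨ε, hε⟩ := hB.exists_augmentation
  have hε0 : ∀ b ∈ positivePart ℬ, ε b = 0 := hB.augmentation_eq_zero hε
  have hdec : kunneth 𝒜 ℬ 2 ≤ LinearMap.range ((TensorProduct.mk k A B).flip 1) ⊔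
      (LinearMap.ker (contractRight A ε) ⊓ Y) := by
    refine kunneth_le fun i j hij v hv w hw => ?_
    obtain ⟨rfl, rfl⟩ | ⟨rfl, rfl⟩ | ⟨rfl, rfl⟩ :
      i = 0 ∧ j = 2 ∨ i = 1 ∧ j = 1 ∨ i = 2 ∧ j = 0 := by omega
    · refine Submodule.mem_sup_right (Submodule.mem_inf.2 ⟨?_, h02 v hv w hw⟩)
      rw [LinearMap.mem_ker, contractRight_tmul, hε0 _ (le_positivePart Nat.two_pos hw), zero_smul]
    · refine Submodule.mem_sup_right (Submodule.mem_inf.2 ⟨?_, h11 v hv w hw⟩)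
      rw [LinearMap.mem_ker, contractRight_tmul, hε0 _ (le_positivePart Nat.one_pos hw), zero_smul]
    · obtain ⟨r, rfl⟩ := hB.exists_algebraMap hw
      refine Submodule.mem_sup_left ⟨r • v, ?_⟩
      rw [Algebra.algebraMap_eq_smul_one, ← TensorProduct.smul_tmul, LinearMap.flip_apply,
        TensorProduct.mk_apply]
  obtain ⟨_, ⟨v, rfl⟩, z, hz, rfl⟩ := Submodule.mem_sup.1 (hdec hx)
  obtain ⟨hz, hzY⟩ := Submodule.mem_inf.1 hz
  have hv := LinearMap.mem_ker.1 (tensorSub_le_ker_contractRight hε0 _ hx')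
  rw [map_add, LinearMap.mem_ker.1 hz, add_zero, LinearMap.flip_apply, TensorProduct.mk_apply,
    contractRight_tmul, map_one, one_smul] at hv
  rw [hv, map_zero, zero_add]
  exact hzY

omit [GradedAlgebra 𝒜] [GradedAlgebra ℬ] in
theorem GradedTwistingMap.map_tmul_mem_kunneth_two (τ : GradedTwistingMap 𝒜 ℬ) {a : A}
    (ha : a ∈ 𝒜 1) {b : B} (hb : b ∈ ℬ 1) : τ.toMap (b ⊗ₜ a) ∈ kunneth 𝒜 ℬ 2 :=
  τ.map_mem 2 _ (tmul_mem_kunneth (p := 1) (q := 1) hb ha)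

end DegreeTwo

section QuadraticAlgebra

variable {k R : Type*} [Field k] [Ring R] [Algebra k R] {𝒜 : ℕ → Submodule k R}

theorem canonicalMap_ι (x : 𝒜 1) : canonicalMap 𝒜 (TensorAlgebra.ι k x) = x :=
  TensorAlgebra.lift_ι_apply _ _

variable [GradedAlgebra 𝒜]

/-- In a one-generated algebra, the elements of degree two are values of words of length two. -/
theorem IsOneGenerated.exists_canonicalMap_eq (h : IsOneGenerated 𝒜) {a : R} (ha : a ∈ 𝒜 2) :
    ∃ x ∈ LinearMap.range (TensorAlgebra.ι k (M := 𝒜 1)) ^ 2, canonicalMap 𝒜 x = a := by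
  obtain ⟨t, rfl⟩ := h a
  have hι : (LinearMap.range (TensorAlgebra.ι k (M := 𝒜 1))).map
      (canonicalMap 𝒜).toLinearMap ≤ 𝒜 1 := by
    rintro _ ⟨_, ⟨x, rfl⟩, rfl⟩
    rw [AlgHom.toLinearMap_apply, canonicalMap_ι]
    exact x.2
  have hpow : ∀ n, ∀ x ∈ LinearMap.range (TensorAlgebra.ι k (M := 𝒜 1)) ^ n,
      canonicalMap 𝒜 x ∈ 𝒜 1 ^ n := by
    intro n x hx
    have : (LinearMap.range (TensorAlgebra.ι k (M := 𝒜 1)) ^ n).map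
        (canonicalMap 𝒜).toLinearMap ≤ 𝒜 1 ^ n := by
      rw [Submodule.map_pow]
      exact pow_le_pow_left' hι n
    exact this ⟨x, hx, rfl⟩
  have hpow' : ∀ n, 𝒜 1 ^ n ≤ 𝒜 n := by
    intro n
    induction n with
    | zero => exact Submodule.one_le.2 (SetLike.one_mem_graded 𝒜)
    | succ n ih =>
      rw [pow_succ, Submodule.mul_le]
      exact fun x hx y hy => SetLike.mul_mem_graded (ih hx) hy
  have hd := decompose_map (𝒜 := fun n => LinearMap.range (TensorAlgebra.ι k (M := 𝒜 1)) ^ n)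
    (𝒜' := 𝒜) (canonicalMap 𝒜).toLinearMap (fun m x hx => hpow' m (hpow m x hx)) t 2
  rw [AlgHom.toLinearMap_apply, DirectSum.decompose_of_mem_same 𝒜 ha] at hd
  exact ⟨_, SetLike.coe_mem _, hd.symm⟩

omit [GradedAlgebra 𝒜] in
variable (𝒜) in
theorem quadraticRelations_le_ker :
    quadraticRelations 𝒜 ≤ TwoSidedIdeal.ker (canonicalMap 𝒜) :=
  TwoSidedIdeal.span_le.2 fun _ hx => (TwoSidedIdeal.mem_ker _).2 hx.1

end QuadraticAlgebra

section QuadraticTwisted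

variable {k A B : Type*} [Field k] [Ring A] [Algebra k A] [Ring B] [Algebra k B]

namespace GradedTwistingMap

open TwistedTensorProduct

variable {𝒜 : ℕ → Submodule k A} [GradedAlgebra 𝒜] {ℬ : ℕ → Submodule k B} [GradedAlgebra ℬ]
  (τ : GradedTwistingMap 𝒜 ℬ)

/-- The inclusion `A_1 → (A ⊗_τ B)_1`. -/
def degreeOneLeft : 𝒜 1 →ₗ[k] τ.grading 1 :=
  (inclLeft τ.toTwistingMap).toLinearMap.restrict (τ.inclLeft_mem 1)

/-- The inclusion `B_1 → (A ⊗_τ B)_1`. -/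
def degreeOneRight : ℬ 1 →ₗ[k] τ.grading 1 :=
  (inclRight τ.toTwistingMap).toLinearMap.restrict (τ.inclRight_mem 1)

/-- The map of tensor algebras induced by `A_1 → (A ⊗_τ B)_1`. -/
def tensorLeft : TensorAlgebra k (𝒜 1) →ₐ[k] TensorAlgebra k (τ.grading 1) :=
  TensorAlgebra.lift k (TensorAlgebra.ι k ∘ₗ τ.degreeOneLeft)

/-- The map of tensor algebras induced by `B_1 → (A ⊗_τ B)_1`. -/
def tensorRight : TensorAlgebra k (ℬ 1) →ₐ[k] TensorAlgebra k (τ.grading 1) :=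
  TensorAlgebra.lift k (TensorAlgebra.ι k ∘ₗ τ.degreeOneRight)

omit [GradedAlgebra 𝒜] in
theorem tensorLeft_ι (a : 𝒜 1) :
    τ.tensorLeft (TensorAlgebra.ι k a) = TensorAlgebra.ι k (τ.degreeOneLeft a) :=
  TensorAlgebra.lift_ι_apply _ _

omit [GradedAlgebra ℬ] in
theorem tensorRight_ι (b : ℬ 1) :
    τ.tensorRight (TensorAlgebra.ι k b) = TensorAlgebra.ι k (τ.degreeOneRight b) :=
  TensorAlgebra.lift_ι_apply _ _

omit [GradedAlgebra 𝒜] in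
theorem canonicalMap_tensorLeft (x : TensorAlgebra k (𝒜 1)) :
    canonicalMap τ.grading (τ.tensorLeft x) = inclLeft τ.toTwistingMap (canonicalMap 𝒜 x) := by
  have : (canonicalMap τ.grading).comp τ.tensorLeft =
      (inclLeft τ.toTwistingMap).comp (canonicalMap 𝒜) := by
    refine TensorAlgebra.hom_ext (LinearMap.ext fun a => ?_)
    change canonicalMap τ.grading (τ.tensorLeft (TensorAlgebra.ι k a)) =
      inclLeft τ.toTwistingMap (canonicalMap 𝒜 (TensorAlgebra.ι k a))
    rw [tensorLeft_ι, canonicalMap_ι, canonicalMap_ι]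
    rfl
  exact DFunLike.congr_fun this x

omit [GradedAlgebra ℬ] in
theorem canonicalMap_tensorRight (x : TensorAlgebra k (ℬ 1)) :
    canonicalMap τ.grading (τ.tensorRight x) = inclRight τ.toTwistingMap (canonicalMap ℬ x) := by
  have : (canonicalMap τ.grading).comp τ.tensorRight =
      (inclRight τ.toTwistingMap).comp (canonicalMap ℬ) := by
    refine TensorAlgebra.hom_ext (LinearMap.ext fun a => ?_)
    change canonicalMap τ.grading (τ.tensorRight (TensorAlgebra.ι k a)) =
      inclRight τ.toTwistingMap (canonicalMap ℬ (TensorAlgebra.ι k a))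
    rw [tensorRight_ι, canonicalMap_ι, canonicalMap_ι]
    rfl
  exact DFunLike.congr_fun this x

theorem toTensor_canonicalMap (x : TensorAlgebra k (𝒜 1)) (y : TensorAlgebra k (ℬ 1)) :
    toTensor τ.toTwistingMap (canonicalMap τ.grading (τ.tensorLeft x * τ.tensorRight y)) =
      canonicalMap 𝒜 x ⊗ₜ canonicalMap ℬ y := by
  rw [map_mul, canonicalMap_tensorLeft, canonicalMap_tensorRight, toTensor_inclLeft_mul_inclRight]

theorem isOneGenerated_grading (hA : IsOneGenerated 𝒜) (hB : IsOneGenerated ℬ) :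
    IsOneGenerated τ.grading := by
  intro c
  change c ∈ LinearMap.range (canonicalMap τ.grading).toLinearMap
  rw [← (toTensor τ.toTwistingMap).symm_apply_apply c]
  induction toTensor τ.toTwistingMap c with
  | zero => simp
  | add x y hx hy => rw [map_add]; exact Submodule.add_mem _ hx hy
  | tmul a b =>
    obtain ⟨x, rfl⟩ := hA a
    obtain ⟨y, rfl⟩ := hB b
    exact ⟨_, by rw [← toTensor_canonicalMap, LinearEquiv.symm_apply_apply]; rfl⟩

/-- The relations of `A`, as relations of `A ⊗_τ B`. -/
theorem tensorLeft_mem_quadraticRelations (hA : IsQuadratic 𝒜) {x : TensorAlgebra k (𝒜 1)}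
    (hx : canonicalMap 𝒜 x = 0) : τ.tensorLeft x ∈ quadraticRelations τ.grading := by
  have h : quadraticRelations 𝒜 ≤ (quadraticRelations τ.grading).comap τ.tensorLeft := by
    refine TwoSidedIdeal.span_le.2 fun y ⟨hy, hy2⟩ => ?_
    refine (TwoSidedIdeal.mem_comap _).2 (TwoSidedIdeal.subset_span ⟨?_, ?_⟩)
    · rw [canonicalMap_tensorLeft, hy, map_zero]
    · have : (LinearMap.range (TensorAlgebra.ι k (M := 𝒜 1)) ^ 2).map τ.tensorLeft.toLinearMap ≤
          LinearMap.range (TensorAlgebra.ι k (M := τ.grading 1)) ^ 2 := by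
        rw [Submodule.map_pow]
        refine pow_le_pow_left' ?_ 2
        rintro _ ⟨_, ⟨a, rfl⟩, rfl⟩
        exact ⟨_, (τ.tensorLeft_ι a).symm⟩
      exact this ⟨y, hy2, rfl⟩
  refine (TwoSidedIdeal.mem_comap _).1 (h ?_)
  rw [← hA.ker_eq]
  exact (TwoSidedIdeal.mem_ker _).2 hx

/-- The relations of `B`, as relations of `A ⊗_τ B`. -/
theorem tensorRight_mem_quadraticRelations (hB : IsQuadratic ℬ) {x : TensorAlgebra k (ℬ 1)}
    (hx : canonicalMap ℬ x = 0) : τ.tensorRight x ∈ quadraticRelations τ.grading := by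
  have h : quadraticRelations ℬ ≤ (quadraticRelations τ.grading).comap τ.tensorRight := by
    refine TwoSidedIdeal.span_le.2 fun y ⟨hy, hy2⟩ => ?_
    refine (TwoSidedIdeal.mem_comap _).2 (TwoSidedIdeal.subset_span ⟨?_, ?_⟩)
    · rw [canonicalMap_tensorRight, hy, map_zero]
    · have : (LinearMap.range (TensorAlgebra.ι k (M := ℬ 1)) ^ 2).map τ.tensorRight.toLinearMap ≤
          LinearMap.range (TensorAlgebra.ι k (M := τ.grading 1)) ^ 2 := by
        rw [Submodule.map_pow]
        refine pow_le_pow_left' ?_ 2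
        rintro _ ⟨_, ⟨a, rfl⟩, rfl⟩
        exact ⟨_, (τ.tensorRight_ι a).symm⟩
      exact this ⟨y, hy2, rfl⟩
  refine (TwoSidedIdeal.mem_comap _).1 (h ?_)
  rw [← hB.ker_eq]
  exact (TwoSidedIdeal.mem_ker _).2 hx

theorem range_degreeOne (hA : IsConnectedGraded 𝒜) (hB : IsConnectedGraded ℬ) :
    LinearMap.range τ.degreeOneLeft ⊔ LinearMap.range τ.degreeOneRight = ⊤ := by
  refine eq_top_iff.2 fun c _ => ?_
  have h : kunneth 𝒜 ℬ 1 ≤ (LinearMap.range τ.degreeOneLeft ⊔ LinearMap.range τ.degreeOneRight).map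
      ((toTensor τ.toTwistingMap).toLinearMap ∘ₗ (τ.grading 1).subtype) := by
    refine kunneth_le fun p q hpq a ha b hb => ?_
    obtain ⟨rfl, rfl⟩ | ⟨rfl, rfl⟩ : p = 1 ∧ q = 0 ∨ p = 0 ∧ q = 1 := by omega
    · obtain ⟨r, rfl⟩ := hB.exists_algebraMap hb
      refine ⟨_, Submodule.mem_sup_left ⟨r • ⟨a, ha⟩, rfl⟩, ?_⟩
      rw [Algebra.algebraMap_eq_smul_one, TensorProduct.tmul_smul, TensorProduct.smul_tmul']
      rfl
    · obtain ⟨r, rfl⟩ := hA.exists_algebraMap ha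
      refine ⟨_, Submodule.mem_sup_right ⟨r • ⟨b, hb⟩, rfl⟩, ?_⟩
      rw [Algebra.algebraMap_eq_smul_one, TensorProduct.smul_tmul]
      rfl
  obtain ⟨c', hc', e⟩ := h (τ.mem_grading.1 c.2)
  have : c' = c := Subtype.ext ((toTensor τ.toTwistingMap).injective e)
  exact this ▸ hc'

/-- The degree one part of `A`, inside the tensor algebra of `(A ⊗_τ B)_1`. -/
def lettersLeft : Submodule k (TensorAlgebra k (τ.grading 1)) :=
  LinearMap.range (TensorAlgebra.ι k ∘ₗ τ.degreeOneLeft)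

/-- The degree one part of `B`, inside the tensor algebra of `(A ⊗_τ B)_1`. -/
def lettersRight : Submodule k (TensorAlgebra k (τ.grading 1)) :=
  LinearMap.range (TensorAlgebra.ι k ∘ₗ τ.degreeOneRight)

theorem letters_sup (hA : IsConnectedGraded 𝒜) (hB : IsConnectedGraded ℬ) :
    τ.lettersLeft ⊔ τ.lettersRight = LinearMap.range (TensorAlgebra.ι k (M := τ.grading 1)) := by
  rw [lettersLeft, lettersRight, LinearMap.range_comp, LinearMap.range_comp, ← Submodule.map_sup,
    τ.range_degreeOne hA hB, Submodule.map_top]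

/-- The quadratic relations of `A ⊗_τ B`, as a subspace of the tensor algebra. -/
def relationSubmodule : Submodule k (TensorAlgebra k (τ.grading 1)) :=
  (quadraticRelations τ.grading).asIdeal.restrictScalars k

omit [GradedAlgebra 𝒜] [GradedAlgebra ℬ] in
theorem mem_relationSubmodule {x : TensorAlgebra k (τ.grading 1)} :
    x ∈ τ.relationSubmodule ↔ x ∈ quadraticRelations τ.grading := Iff.rfl

/-- The canonical map to `A ⊗_τ B`, viewed as a map to `A ⊗ B`. -/
def wordMap : TensorAlgebra k (τ.grading 1) →ₗ[k] A ⊗[k] B :=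
  (toTensor τ.toTwistingMap).toLinearMap ∘ₗ (canonicalMap τ.grading).toLinearMap

/-- If the products `τ(b ⊗ a)` of letters are values of the words in `Y`, then `b a` is congruent to
an element of `Y` modulo the quadratic relations. -/
theorem letters_mul_le (hA : IsConnectedGraded 𝒜) (hB : IsConnectedGraded ℬ)
    {Y : Submodule k (TensorAlgebra k (τ.grading 1))}
    (hY : Y ≤ (τ.lettersLeft ⊔ τ.lettersRight) ^ 2)
    (h : ∀ a ∈ 𝒜 1, ∀ b ∈ ℬ 1, τ.toMap (b ⊗ₜ a) ∈ Y.map τ.wordMap) :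
    τ.lettersRight * τ.lettersLeft ≤ Y ⊔ τ.relationSubmodule := by
  rw [Submodule.mul_le]
  rintro _ ⟨b, rfl⟩ _ ⟨a, rfl⟩
  obtain ⟨y, hy, e⟩ := h a a.2 b b.2
  rw [← toTensor_inclRight_mul_inclLeft] at e
  have e' : canonicalMap τ.grading y = inclRight _ (b : B) * inclLeft _ (a : A) :=
    (toTensor τ.toTwistingMap).injective e
  refine Submodule.mem_sup.2 ⟨y, hy, _, ?_, add_sub_cancel _ _⟩
  refine TwoSidedIdeal.subset_span ⟨?_, Submodule.sub_mem _ ?_ ?_⟩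
  · rw [map_sub, map_mul, e', LinearMap.comp_apply, LinearMap.comp_apply, canonicalMap_ι,
      canonicalMap_ι]
    exact sub_self _
  · rw [pow_two]
    exact Submodule.mul_mem_mul ⟨_, rfl⟩ ⟨_, rfl⟩
  · rw [← τ.letters_sup hA hB]
    exact hY hy

omit [GradedAlgebra 𝒜] in
theorem map_tensorLeft_pow (n : ℕ) : (LinearMap.range (TensorAlgebra.ι k (M := 𝒜 1)) ^ n).map
    τ.tensorLeft.toLinearMap = τ.lettersLeft ^ n := by
  rw [Submodule.map_pow, ← LinearMap.range_comp]
  congr 2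
  exact LinearMap.ext τ.tensorLeft_ι

omit [GradedAlgebra ℬ] in
theorem map_tensorRight_pow (n : ℕ) : (LinearMap.range (TensorAlgebra.ι k (M := ℬ 1)) ^ n).map
    τ.tensorRight.toLinearMap = τ.lettersRight ^ n := by
  rw [Submodule.map_pow, ← LinearMap.range_comp]
  congr 2
  exact LinearMap.ext τ.tensorRight_ι

theorem tmul_mem_map_lettersLeft_mul_lettersRight {a : A} (ha : a ∈ 𝒜 1) {b : B} (hb : b ∈ ℬ 1) :
    a ⊗ₜ b ∈ (τ.lettersLeft * τ.lettersRight).map τ.wordMap := by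
  refine ⟨_, Submodule.mul_mem_mul ⟨⟨a, ha⟩, (τ.tensorLeft_ι _).symm⟩
    ⟨⟨b, hb⟩, (τ.tensorRight_ι _).symm⟩, (τ.toTensor_canonicalMap _ _).trans ?_⟩
  rw [canonicalMap_ι, canonicalMap_ι]

theorem tmul_mem_map_lettersLeft_sq (hA : IsOneGenerated 𝒜) (hB : IsConnectedGraded ℬ) {a : A}
    (ha : a ∈ 𝒜 2) {b : B} (hb : b ∈ ℬ 0) : a ⊗ₜ b ∈ (τ.lettersLeft ^ 2).map τ.wordMap := by
  obtain ⟨r, rfl⟩ := hB.exists_algebraMap hb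
  obtain ⟨x, hx, rfl⟩ := hA.exists_canonicalMap_eq ha
  rw [Algebra.algebraMap_eq_smul_one, TensorProduct.tmul_smul]
  refine Submodule.smul_mem _ _ ⟨τ.tensorLeft x * τ.tensorRight 1, ?_,
    (τ.toTensor_canonicalMap _ _).trans (by rw [map_one])⟩
  rw [map_one, mul_one, ← map_tensorLeft_pow]
  exact ⟨x, hx, rfl⟩

theorem tmul_mem_map_lettersRight_sq (hA : IsConnectedGraded 𝒜) (hB : IsOneGenerated ℬ) {a : A}
    (ha : a ∈ 𝒜 0) {b : B} (hb : b ∈ ℬ 2) : a ⊗ₜ b ∈ (τ.lettersRight ^ 2).map τ.wordMap := by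
  obtain ⟨r, rfl⟩ := hA.exists_algebraMap ha
  obtain ⟨x, hx, rfl⟩ := hB.exists_canonicalMap_eq hb
  rw [Algebra.algebraMap_eq_smul_one, ← TensorProduct.smul_tmul']
  refine Submodule.smul_mem _ _ ⟨τ.tensorLeft 1 * τ.tensorRight x, ?_,
    (τ.toTensor_canonicalMap _ _).trans (by rw [map_one])⟩
  rw [map_one, one_mul, ← map_tensorRight_pow]
  exact ⟨x, hx, rfl⟩

/-- If `τ(B_+ ⊗ A_+) ⊆ A_+ ⊗ B`, then the words `b a` can be rewritten to begin with a letter of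
`A`. -/
theorem letters_mul_le_left (hA : IsQuadratic 𝒜) (hB : IsQuadratic ℬ)
    (hτ : ∀ x ∈ tensorSub (positivePart ℬ) (positivePart 𝒜), τ.toMap x ∈
      tensorSub (positivePart 𝒜) (ℬ 0) ⊔ tensorSub (positivePart 𝒜) (positivePart ℬ)) :
    τ.lettersRight * τ.lettersLeft ≤
      τ.lettersLeft * (τ.lettersLeft ⊔ τ.lettersRight) ⊔ τ.relationSubmodule := by
  have hle : tensorSub (positivePart 𝒜) (ℬ 0) ⊔ tensorSub (positivePart 𝒜) (positivePart ℬ) ≤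
      tensorSub (positivePart 𝒜) ⊤ :=
    sup_le (tensorSub_mono le_rfl le_top) (tensorSub_mono le_rfl le_top)
  refine τ.letters_mul_le hA.connected hB.connected
    (by rw [pow_two]; exact mul_le_mul' le_sup_left le_rfl) fun a ha b hb => ?_
  refine mem_of_mem_kunneth_two_left hA.connected (fun a ha b hb => ?_) (fun a ha b hb => ?_)
    (τ.map_tmul_mem_kunneth_two ha hb)
    (hle (hτ _ (tmul_mem_tensorSub (le_positivePart Nat.one_pos hb)
      (le_positivePart Nat.one_pos ha))))
  · exact Submodule.map_mono (mul_le_mul' le_rfl le_sup_right)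
      (τ.tmul_mem_map_lettersLeft_mul_lettersRight ha hb)
  · exact Submodule.map_mono ((pow_two _).trans_le (mul_le_mul' le_rfl le_sup_left))
      (τ.tmul_mem_map_lettersLeft_sq hA.oneGenerated hB.connected ha hb)

/-- If `τ(B_+ ⊗ A_+) ⊆ A ⊗ B_+`, then the words `b a` can be rewritten to end with a letter of
`B`. -/
theorem letters_mul_le_right (hA : IsQuadratic 𝒜) (hB : IsQuadratic ℬ)
    (hτ : ∀ x ∈ tensorSub (positivePart ℬ) (positivePart 𝒜), τ.toMap x ∈
      tensorSub (positivePart 𝒜) (positivePart ℬ) ⊔ tensorSub (𝒜 0) (positivePart ℬ)) :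
    τ.lettersRight * τ.lettersLeft ≤
      (τ.lettersLeft ⊔ τ.lettersRight) * τ.lettersRight ⊔ τ.relationSubmodule := by
  have hle : tensorSub (positivePart 𝒜) (positivePart ℬ) ⊔ tensorSub (𝒜 0) (positivePart ℬ) ≤
      tensorSub ⊤ (positivePart ℬ) :=
    sup_le (tensorSub_mono le_top le_rfl) (tensorSub_mono le_top le_rfl)
  refine τ.letters_mul_le hA.connected hB.connected
    (by rw [pow_two]; exact mul_le_mul' le_rfl le_sup_right) fun a ha b hb => ?_
  refine mem_of_mem_kunneth_two_right hB.connected (fun a ha b hb => ?_) (fun a ha b hb => ?_)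
    (τ.map_tmul_mem_kunneth_two ha hb)
    (hle (hτ _ (tmul_mem_tensorSub (le_positivePart Nat.one_pos hb)
      (le_positivePart Nat.one_pos ha))))
  · exact Submodule.map_mono (mul_le_mul' le_sup_left le_rfl)
      (τ.tmul_mem_map_lettersLeft_mul_lettersRight ha hb)
  · exact Submodule.map_mono ((pow_two _).trans_le (mul_le_mul' le_sup_right le_rfl))
      (τ.tmul_mem_map_lettersRight_sq hA.connected hB.oneGenerated ha hb)

theorem isQuadratic_grading (hτ : τ.IsOneSided) (hA : IsQuadratic 𝒜) (hB : IsQuadratic ℬ) :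
    IsQuadratic τ.grading := by
  refine ⟨τ.isConnectedGraded_grading hA.connected hB.connected,
    τ.isLocallyFinite_grading hA.locallyFinite hB.locallyFinite,
    τ.isOneGenerated_grading hA.oneGenerated hB.oneGenerated, le_antisymm ?_ ?_⟩
  · intro t ht
    rw [TwoSidedIdeal.mem_ker] at ht
    have hl : ∀ X, X * τ.relationSubmodule ≤ τ.relationSubmodule := fun X =>
      Submodule.mul_le.2 fun x _ y hy => τ.mem_relationSubmodule.2
        (TwoSidedIdeal.mul_mem_left _ x y (τ.mem_relationSubmodule.1 hy))
    have hr : ∀ X, τ.relationSubmodule * X ≤ τ.relationSubmodule := fun X =>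
      Submodule.mul_le.2 fun x hx y _ => τ.mem_relationSubmodule.2
        (TwoSidedIdeal.mul_mem_right _ x y (τ.mem_relationSubmodule.1 hx))
    have hV : τ.lettersLeft ≤ τ.tensorLeft.range.toSubmodule := by
      rintro _ ⟨a, rfl⟩
      exact ⟨_, τ.tensorLeft_ι a⟩
    have hW : τ.lettersRight ≤ τ.tensorRight.range.toSubmodule := by
      rintro _ ⟨b, rfl⟩
      exact ⟨_, τ.tensorRight_ι b⟩
    have hpow := sup_pow_le_mul hl hr
      (hτ.imp (τ.letters_mul_le_left hA hB) (τ.letters_mul_le_right hA hB)) hV hW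
    classical
    -- Modulo the quadratic relations, `t` is a combination of words in `A_1` followed by words in
    -- `B_1`, that is, it comes from `T(A_1) ⊗ T(B_1)`.
    have htop : t ∈ τ.tensorLeft.range.toSubmodule * τ.tensorRight.range.toSubmodule ⊔
        τ.relationSubmodule := by
      rw [← DirectSum.sum_support_decompose (fun n =>
        LinearMap.range (TensorAlgebra.ι k (M := τ.grading 1)) ^ n) t]
      refine Submodule.sum_mem _ fun n _ => hpow n ?_
      rw [τ.letters_sup hA.connected hB.connected]
      exact SetLike.coe_mem _
    let Ψ : TensorAlgebra k (𝒜 1) ⊗[k] TensorAlgebra k (ℬ 1) →ₗ[k] TensorAlgebra k (τ.grading 1) :=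
      LinearMap.mul' k _ ∘ₗ TensorProduct.map τ.tensorLeft.toLinearMap τ.tensorRight.toLinearMap
    have hΨ : τ.tensorLeft.range.toSubmodule * τ.tensorRight.range.toSubmodule ≤
        LinearMap.range Ψ := by
      rw [Submodule.mul_le]
      rintro _ ⟨x, rfl⟩ _ ⟨y, rfl⟩
      exact ⟨x ⊗ₜ y, rfl⟩
    have hΨmap : τ.wordMap ∘ₗ Ψ = TensorProduct.map (canonicalMap 𝒜).toLinearMap
        (canonicalMap ℬ).toLinearMap :=
      TensorProduct.ext' τ.toTensor_canonicalMap
    obtain ⟨_, hs, j, hj, rfl⟩ := Submodule.mem_sup.1 htop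
    obtain ⟨s, rfl⟩ := hΨ hs
    refine TwoSidedIdeal.add_mem _ ?_ hj
    have hj0 : canonicalMap τ.grading j = 0 :=
      (TwoSidedIdeal.mem_ker _).1 (quadraticRelations_le_ker _ hj)
    have hs0 : s ∈ LinearMap.ker (TensorProduct.map (canonicalMap 𝒜).toLinearMap
        (canonicalMap ℬ).toLinearMap) := by
      rw [map_add, hj0, add_zero] at ht
      rw [← hΨmap, LinearMap.mem_ker]
      exact (congrArg (toTensor τ.toTwistingMap) ht).trans (map_zero _)
    -- The kernel of `π_A ⊗ π_B` is `T(A_1) ⊗ ker π_B + ker π_A ⊗ T(B_1)`.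
    rw [TensorProduct.map_ker (LinearMap.exact_subtype_ker_map (canonicalMap 𝒜).toLinearMap)
      hA.oneGenerated (LinearMap.exact_subtype_ker_map (canonicalMap ℬ).toLinearMap)
      hB.oneGenerated] at hs0
    have hker : LinearMap.range (LinearMap.lTensor (TensorAlgebra k (𝒜 1))
          (LinearMap.ker (canonicalMap ℬ).toLinearMap).subtype) ⊔
        LinearMap.range (LinearMap.rTensor (TensorAlgebra k (ℬ 1))
          (LinearMap.ker (canonicalMap 𝒜).toLinearMap).subtype) ≤ τ.relationSubmodule.comap Ψ := by
      refine sup_le ?_ ?_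
      · rintro _ ⟨u, rfl⟩
        induction u with
        | zero => simp
        | add u v hu hv => rw [map_add]; exact Submodule.add_mem _ hu hv
        | tmul x y =>
          exact TwoSidedIdeal.mul_mem_left _ _ _ (τ.tensorRight_mem_quadraticRelations hB y.2)
      · rintro _ ⟨u, rfl⟩
        induction u with
        | zero => simp
        | add u v hu hv => rw [map_add]; exact Submodule.add_mem _ hu hv
        | tmul x y =>
          exact TwoSidedIdeal.mul_mem_right _ _ _ (τ.tensorLeft_mem_quadraticRelations hA x.2)
    exact hker hs0
  · exact quadraticRelations_le_ker _

end GradedTwistingMap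

end QuadraticTwisted

end TwistedKoszul

end

open TwistedKoszul in
theorem theorem5p3 {k A B : Type*} [Field k] [Ring A] [Algebra k A] [Ring B] [Algebra k B]
    (𝒜 : ℕ → Submodule k A) [GradedAlgebra 𝒜] (ℬ : ℕ → Submodule k B) [GradedAlgebra ℬ]
    (τ : GradedTwistingMap 𝒜 ℬ) (hτ : τ.IsOneSided) :
    (IsQuadratic 𝒜 → IsQuadratic ℬ → IsQuadratic τ.grading) ∧
    (IsKoszul 𝒜 → IsKoszul ℬ → IsKoszul τ.grading) :=
  ⟨τ.isQuadratic_grading hτ, τ.isKoszul_grading hτ⟩
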